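/- **Conventions.** Let $G=\mathbb Z_k$, $k\ge 1$. A finite set $D\subseteq G$ is *dissociated* if $\sum_{d\in D}\epsilon_d d\ne 0$ for all $(\epsilon_d)\in\{-1,0,1\}^D\setminus\{0\}$. For a sequence $\mathbf b=(b_1,\dots,b_r)$ in $G$ put $\overline{\mathbf b}=(b_r,\dots,b_1)$ and $\mathrm{IS}(\mathbf b)=\{b_1+\dots+b_j:0\le j\le r\}$. An *interval* of $[1,N]$ is a nonempty set of consecutive integers; it is *proper* if it is not all of $[1,N]$. A sequence $a_1,\dots,a_N$ is a *$t$-weak sequencing* if $\sum_{i\in I}a_i\neq0$ for every proper interval $I\subset[1,N]$ with $|I|\le t$ (equivalently, partial sums, the empty one included, with indices at distance between $1$ and $t$ are distinct, the pair formed by the empty and the total sum being exempt). **Data.** Let $s\ge2$, and let $D_1,\dots,D_s\subseteq \mathbb Z_k$ be pairwise disjoint dissociated sets with $\alpha R\le|D_j|\le\beta R$ and $4\mid|D_j|$. Let $\delta=\sum_j\sum_{d\in D_j}d$, and suppose that $D_1\cup D_s\cup\{\delta\}$ is dissociated. Let $\mathbf p,\mathbf n$ be finite sequences in $\mathbb Z_k$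 such that $\overline{\mathbf p},\delta,\mathbf n$ is a $t$-weak sequencing. Let $K=\lfloor c_2R^{1/2}\rfloor$. **Splitting.** Independently, choose uniformly random permutations $\sigma_1$ of $D_1$ and $\sigma_s$ of $D_s$, and for $1<j<s$ a uniformly random ordered partition $D_j=D_j^{(1)}\sqcup\dots\sqcup D_j^{(4)}$ into parts of size $|D_j|/4$; for $j\in\{1,s\}$ let $D_j^{(1)},\dots,D_j^{(4)}$ be the four consecutive segments of equal length of $\sigma_j$. Let $T_1,\dots,T_u$ ($u=4s$) be the blocks $$D_1^{(1)},D_1^{(2)},D_2^{(1)},D_2^{(2)},\dots,D_s^{(1)},D_s^{(2)},D_1^{(3)},D_1^{(4)},\dots,D_s^{(3)},D_s^{(4)},$$ in this order. Let $\mathbf t_1$, $\mathbf t_u$ be the orders induced on $T_1$, $T_u$ by $\sigma_1$, $\sigma_s$. *Acceptability.* $\mathbf t_1$ is acceptable if, for $1\le h\le K$, the sum of its first $h$ entries is not in $-\mathrm{IS}(\mathbf p)\cup(\delta+\mathrm{IS}(\mathbf n))$; $\mathbf t_u$ is acceptable if, for $1\le h\le K$, the sum of its last $h$ entries is not in $-\mathrm{IS}(\mathbf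 n)\cup(\delta+\mathrm{IS}(\mathbf p))$. Condition the splitting on the event that $\mathbf t_1$ and $\mathbf t_u$ are both acceptable, and suppose that this event has probability at least $\eta$. **Orders.** Given the splitting, choose, independently for $1\le j\le 2s-1$, a pair $(\mathbf t_{2j},\mathbf t_{2j+1})$ of orderings of $T_{2j}$ and $T_{2j+1}$ uniformly among the *permissible* pairs, i.e. those for which, for all $1\le h,h'\le K$, the sum of the last $h$ entries of $\mathbf t_{2j}$ and the first $h'$ entries of $\mathbf t_{2j+1}$ is nonzero. Let $a_1,\dots,a_N$ be the concatenation $\overline{\mathbf p},\mathbf t_1,\dots,\mathbf t_u,\mathbf n$. A proper interval $I\subset[1,N]$ is of *Type II* if for some $j$ it contains at least $K$ and at most $|T_j|-K$ of the positions of the block $\mathbf t_j$; otherwise it is of *Type I*. **Lemma (One-shot Type I/II control).** For all $0<\alpha\le\beta$ there are constants $c_0,c,\gamma>0$ such that for all $0<c_2\le c_0$ and $\eta>0$ there is $R_0$ such that the following holds for all real $R\ge R_0$, all data as above and all integers $0\le t\le\exp(cK)$. The sampling procedure is well defined (there are acceptable splittings, and for each of them permissible pairs exist), and: 1. for every Type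 II interval $I\subset[1,N]$ with $|I|\le t$, $\ \mathbb P\big(\sum_{i\in I}a_i=0\big)\le\exp(-\gamma K\log R)$; 2. for every Type I interval $I\subset[1,N]$ with $|I|\le t$, $\ \mathbb P\big(\sum_{i\in I}a_i=0\big)\le\exp(-\gamma R)$; 3. with positive probability, every interval $I\subset[1,N]$ with $|I|\le t$ has nonzero sum (the whole interval $[1,N]$, whose sum is the deterministic element $\sum\mathbf p+\delta+\sum\mathbf n$, being considered only if that element is nonzero), and therefore $a_1,\dots,a_N$ is a $t$-weak sequencing. -/

import Mathlib

open scoped Pointwise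

noncomputable section

namespace OneShot

variable {G : Type} [AddCommGroup G] [DecidableEq G]

/-- `D` is dissociated: no nontrivial combination with coefficients in `{-1, 0, 1}` vanishes. -/
def IsDissociated (D : Finset G) : Prop :=
  ∀ ε : G → ℤ, (∀ d ∈ D, ε d = -1 ∨ ε d = 0 ∨ ε d = 1) →
    ∑ d ∈ D, ε d • d = 0 → ∀ d ∈ D, ε d = 0

/-- The set of initial segment sums `b₁ + ⋯ + bⱼ`, `0 ≤ j ≤ |b|`. -/
def IS (b : List G) : Set G := {x | ∃ j ≤ b.length, x = (b.take j).sum}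

/-- The sum of the entries of `a` over the interval of (1-based) positions `i+1, …, j`. -/
def intervalSum (a : List G) (i j : ℕ) : G := ((a.take j).drop i).sum

/-- The positions `i+1, …, j` form a proper nonempty interval of `{1, …, N}`. -/
def IsProperInterval (N i j : ℕ) : Prop := i < j ∧ j ≤ N ∧ j - i < N

/-- `t`-weak sequencing: the partial sums with indices `i < j`, `j - i ≤ t` (the empty partial sum,
with index `0`, included) are distinct. As for ordinary sequencings, the pair formed by the empty
and the total sum is exempt. -/
def IsWeakSequencing (t : ℕ) (a : List G) : Prop :=
  ∀ i j, IsProperInterval a.length i j → j - i ≤ t → (a.take i).sum ≠ (a.take j).sum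

/-- All orderings of a finite set. -/
def orderings (X : Finset G) : Finset (List G) := X.val.lists.toFinset

open Classical in
/-- All ordered partitions of `X` into four parts of size `|X| / 4`. -/
def quarterings (X : Finset G) : Finset (Fin 4 → Finset G) :=
  (Fintype.piFinset fun _ : Fin 4 => X.powerset).filter fun P =>
    (∀ a b, a ≠ b → Disjoint (P a) (P b)) ∧ (∀ a, (P a).card = X.card / 4) ∧
      Finset.univ.biUnion P = X

/-- The `a`-th of the four consecutive segments of equal length of a list. -/
def segment (σ : List G) (a : Fin 4) : List G :=
  (σ.drop (a * (σ.length / 4))).take (σ.length / 4)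

/-! Throughout, there are `s = r + 2` dissociated sets `D 0, …, D (Fin.last _)`. -/

/-- `δ`, the sum of all elements of all the sets `D j`. -/
def delta {r : ℕ} (D : Fin (r + 2) → Finset G) : G := ∑ j, ∑ d ∈ D j, d

/-- Data of a splitting: the permutations `σ₁`, `σₛ` of the first and last set, and a partition into
four parts of each of the `r` intermediate sets. -/
abbrev Split (G : Type) (r : ℕ) : Type := List G × List G × (Fin r → Fin 4 → Finset G)

/-- All splittings; a uniform element is a family of independent uniform choices. -/
def splits {r : ℕ} (D : Fin (r + 2) → Finset G) : Finset (Split G r) :=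
  orderings (D 0) ×ˢ orderings (D (Fin.last (r + 1))) ×ˢ
    Fintype.piFinset fun i : Fin r => quarterings (D i.castSucc.succ)

/-- The four parts of every `D j` in a given splitting. -/
def parts {r : ℕ} (w : Split G r) : Fin (r + 2) → Fin 4 → Finset G :=
  Fin.cons (fun a => (segment w.1 a).toFinset)
    (Fin.snoc w.2.2 (fun a => (segment w.2.1 a).toFinset))

/-- The index `j` of the set `D j` of which the `q`-th block is a part. The blocks, `q = 0, 1, …`,
are `D₁⁽¹⁾, D₁⁽²⁾, …, Dₛ⁽¹⁾, Dₛ⁽²⁾, D₁⁽³⁾, D₁⁽⁴⁾, …, Dₛ⁽³⁾, Dₛ⁽⁴⁾`. -/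
def blockSet {r : ℕ} (q : Fin (4 * (r + 2))) : Fin (r + 2) :=
  ⟨q.val % (2 * (r + 2)) / 2, by
    have := Nat.mod_lt q.val (show 0 < 2 * (r + 2) by omega)
    omega⟩

/-- Which of the four parts of `D (blockSet q)` the `q`-th block is. -/
def blockPart {r : ℕ} (q : Fin (4 * (r + 2))) : Fin 4 :=
  ⟨2 * (q.val / (2 * (r + 2))) + q.val % 2, by
    have h : q.val / (2 * (r + 2)) < 2 := by
      rw [Nat.div_lt_iff_lt_mul (by omega)]
      have := q.isLt
      omega
    have := Nat.mod_lt q.val (show 0 < 2 by omega)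
    omega⟩

/-- The `q`-th block `T_{q+1}`. -/
def block {r : ℕ} (w : Split G r) (q : Fin (4 * (r + 2))) : Finset G :=
  parts w (blockSet q) (blockPart q)

/-- The (deterministic) size of the `q`-th block. -/
def blockSize {r : ℕ} (D : Fin (r + 2) → Finset G) (q : Fin (4 * (r + 2))) : ℕ :=
  (D (blockSet q)).card / 4

/-- The number of entries before the `q`-th block, when `m` entries precede all blocks. -/
def blockStart {r : ℕ} (D : Fin (r + 2) → Finset G) (m : ℕ) (q : Fin (4 * (r + 2))) : ℕ :=
  m + ∑ q' ∈ Finset.Iio q, blockSize D q'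

/-- The interval of positions `i+1, …, j` is of Type II: it contains between `K` and `|T| - K`
elements of some block `T`. An interval is of Type I if it is not of Type II. -/
def IsTypeII {r : ℕ} (D : Fin (r + 2) → Finset G) (m K i j : ℕ) : Prop :=
  ∃ q, K ≤ (Finset.Ico i j ∩
        Finset.Ico (blockStart D m q) (blockStart D m q + blockSize D q)).card ∧
    (Finset.Ico i j ∩
        Finset.Ico (blockStart D m q) (blockStart D m q + blockSize D q)).card + K ≤ blockSize D q

/-- `l₁ + ⋯ + l_h ∉ -IS(p) ∪ (δ + IS(n))` for `1 ≤ h ≤ K`. -/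
def IsAcceptable (K : ℕ) (δ : G) (p n l : List G) : Prop :=
  ∀ h, 1 ≤ h → h ≤ K → (l.take h).sum ∉ -IS p ∪ (δ +ᵥ IS n)

/-- No nonempty final segment of `l` of length at most `K`, followed by a nonempty initial segment of
`l'` of length at most `K`, has sum zero. -/
def IsPermissible (K : ℕ) (l l' : List G) : Prop :=
  ∀ i j, 1 ≤ i → i ≤ K → 1 ≤ j → j ≤ K → (l.reverse.take i).sum + (l'.take j).sum ≠ 0

open Classical in
/-- The splittings for which both end orders are acceptable. The last block is read backwards, from
its end adjacent to `n`. -/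
def acceptableSplits {r : ℕ} (D : Fin (r + 2) → Finset G) (K : ℕ) (p n : List G) :
    Finset (Split G r) :=
  (splits D).filter fun w =>
    IsAcceptable K (delta D) p n (segment w.1 0) ∧
      IsAcceptable K (delta D) n p (segment w.2.1 3).reverse

open Classical in
/-- All choices of orders of the blocks of a given splitting: the first and last orders are induced by
`σ₁` and `σₛ`, and the pairs of adjacent blocks `(T₂, T₃), (T₄, T₅), …` (with 0-based indices,
`q` odd and `q + 1`) have permissible pairs of orders. The constraints concern disjoint pairs, so a
uniform element is a family of independent uniform permissible pairs. -/
def arrangements {r : ℕ} (K : ℕ) (w : Split G r) : Finset (Fin (4 * (r + 2)) → List G) :=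
  (Fintype.piFinset fun q => orderings (block w q)).filter fun b =>
    (∀ q, q.val = 0 → b q = segment w.1 0) ∧
    (∀ q, q.val + 1 = 4 * (r + 2) → b q = segment w.2.1 3) ∧
    ∀ q q', q.val % 2 = 1 → q'.val = q.val + 1 → IsPermissible K (b q) (b q')

open Classical in
/-- The probability of an event `E` about the block orders, when first a splitting is drawn uniformly,
conditioned on acceptability, and then, given the splitting, the block orders are drawn uniformly
from the permissible ones. -/
def prob {r : ℕ} (D : Fin (r + 2) → Finset G) (K : ℕ) (p n : List G)
    (E : (Fin (4 * (r + 2)) → List G) → Prop) : ℝ :=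
  (∑ w ∈ acceptableSplits D K p n,
      (((arrangements K w).filter E).card : ℝ) / ((arrangements K w).card : ℝ)) /
    ((acceptableSplits D K p n).card : ℝ)

/-- The sequence `a`: the reverse of `p`, then the ordered blocks, then `n`. -/
def arranged {r : ℕ} (p n : List G) (b : Fin (4 * (r + 2)) → List G) : List G :=
  p.reverse ++ (List.ofFn b).flatten ++ n

/-- The length of the sequence `a`. -/
def totalLength {r : ℕ} (D : Fin (r + 2) → Finset G) (p n : List G) : ℕ :=
  p.length + ∑ j, (D j).card + n.length

end OneShot

end

noncomputable section

set_option linter.unusedSectionVars false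

namespace OneShot

open Finset

/-! ### Binomial coefficients -/

/-! All randomness is used through one symmetry: permuting the elements of a single dissociated set
`D s`. Let an interval have `m` positions in blocks that are parts of `D s`. Under a uniform
permutation of `D s`, its sum becomes a constant plus the sum of a uniformly random `m`-subset of `D
s`. Distinct subsets of a dissociated set have distinct sums, so at most one subset gives total
zero, and this has probability at most `1 / C(|D s|, m)`. If `m` lies between `K` and `|D s| - K`,
this is `exp(-c K log R)`; if `m` and `|D s| - m` are both linear in `R`, it is exponentially small
in `R`.

The symmetry is broken by the conditioning. Permissibility of the pairs touching `D s` is dropped at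
the cost of a factor 2: each such constraint fails with probability at most `K² / |T| ≤ 1/16`, and
there are at most 8 of them. Acceptability of an end order coming from `D s` is dropped at the cost
of a factor `1/η`, by exchanging the `D s`-data between two splittings. The resulting estimate
`choose_mul_mass_le` holds jointly with any event determined by the blocks not touching `D s`.

A Type II interval has a suitable `m` by definition. For Type I there are two cases. Either some `D
s` has one quarter almost entirely inside the interval and another almost entirely outside, and then
`m` is far from both extremes. Or the four quarters of every set behave alike; since the blocks run
twice through all the sets, either all blocks are then almost full or all are almost empty. In this
last case no randomness is needed: the sum is nonzero for every outcome (`intervalSum_ne_zero`), by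
the weak sequencing hypothesis, acceptability, permissibility or dissociation.

For the simultaneous statement, assign to each remaining interval a set `D s` that serves it. By the
joint form of the estimate, its vanishing stays unlikely after conditioning on the nonvanishing of
intervals that avoid every block touching `D s`. At most `8 (t + S) t` intervals of length at most
`t` meet one of those blocks, where `S` bounds the block sizes, and for `t ≤ exp K` the lopsided
local lemma `local_lemma` applies. -/

theorem pow_le_choose_mul_pow (a : ℕ) : ∀ n, a ≤ n → n ^ a ≤ n.choose a * a ^ a := by
  induction a with
  | zero => intro n _; simp
  | succ a ih =>
    intro n hn
    obtain ⟨n, rfl⟩ : ∃ m, n = m + 1 := ⟨n - 1, by omega⟩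
    have hn' : a ≤ n := by omega
    have key : (n + 1) ^ a ≤ n.choose a * (a + 1) ^ a := by
      rcases Nat.eq_zero_or_pos a with rfl | ha
      · simp
      -- This is `(n + 1) / n ≤ (a + 1) / a`, raised to the power `a`.
      · have h1 : (n + 1) ^ a * a ^ a ≤ n ^ a * (a + 1) ^ a := by
          rw [← mul_pow, ← mul_pow]
          exact Nat.pow_le_pow_left (by nlinarith) a
        have h2 : (n + 1) ^ a * a ^ a ≤ (n.choose a * (a + 1) ^ a) * a ^ a := by
          refine h1.trans ((Nat.mul_le_mul_right _ (ih n hn')).trans (le_of_eq (by ring)))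
        exact Nat.le_of_mul_le_mul_right h2 (by positivity)
    calc (n + 1) ^ (a + 1) = (n + 1) * (n + 1) ^ a := by ring
      _ ≤ (n + 1) * (n.choose a * (a + 1) ^ a) := Nat.mul_le_mul_left _ key
      _ = ((n + 1) * n.choose a) * (a + 1) ^ a := by ring
      _ = ((n + 1).choose (a + 1) * (a + 1)) * (a + 1) ^ a := by rw [Nat.add_one_mul_choose_eq]
      _ = _ := by ring

theorem choose_le_choose_of_le_half {n a m : ℕ} (ham : a ≤ m) (hm : 2 * m ≤ n) :
    n.choose a ≤ n.choose m := by
  induction m, ham using Nat.le_induction with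
  | base => exact le_rfl
  | succ m _ ih =>
    exact (ih (by omega)).trans (Nat.choose_le_succ_of_lt_half_left (by omega))

/-- Unimodality and symmetry of a row of Pascal's triangle. It reduces every overlap in a symmetric
range to the threshold value. -/
theorem choose_le_choose_of_between {n a m : ℕ} (ham : a ≤ m) (hm : m + a ≤ n) :
    n.choose a ≤ n.choose m := by
  rcases le_total (2 * m) n with h | h
  · exact choose_le_choose_of_le_half ham h
  · rw [← Nat.choose_symm (show m ≤ n by omega)]
    exact choose_le_choose_of_le_half (by omega) (by omega)

theorem le_choose_of_between {n m : ℕ} (h1 : 1 ≤ m) (h2 : m < n) : n ≤ n.choose m := by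
  simpa using choose_le_choose_of_between h1 (show m + 1 ≤ n by omega)

/-! ### Random permutations of dissociated sets -/

/-- A uniformly random permutation maps `A` onto a set with a prescribed value of an injective
statistic with probability at most `1 / C(|X|, |A|)`. -/
theorem card_perm_filter_mul_choose_le {X : Type*} [Fintype X] [DecidableEq X]
    (A : Finset X) (P : Finset X → Prop) [DecidablePred P]
    (hP : ∀ S T, P S → P T → S = T) :
    ((univ : Finset (Equiv.Perm X)).filter fun π => P (A.map π.toEmbedding)).card *
      (Fintype.card X).choose A.card ≤ (Fintype.card X).factorial := by
  classical
  by_cases hne : ∃ S, S.card = A.card ∧ P S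
  swap
  · rw [Finset.filter_false_of_mem]
    · simp
    · intro π _ h
      exact hne ⟨_, by simp, h⟩
  obtain ⟨S, hS, hPS⟩ := hne
  set N : Finset X → Finset (Equiv.Perm X) :=
    fun T => univ.filter fun π => A.map π.toEmbedding = T with hN
  have hsub : (univ.filter fun π : Equiv.Perm X => P (A.map π.toEmbedding)) ⊆ N S := by
    intro π hπ
    simp only [mem_filter, mem_univ, true_and, hN] at hπ ⊢
    exact hP _ _ hπ hPS
  -- Composition with a permutation carrying `S` to `T` embeds the fibre over `S` in the fibre over
  -- `T`. The fibres are disjoint, so `C(|X|, |A|)` copies of the first fit into the symmetric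
  -- group.
  have hle : ∀ T ∈ powersetCard A.card (univ : Finset X), (N S).card ≤ (N T).card := by
    intro T hT
    rw [mem_powersetCard] at hT
    have e : {x // x ∈ S} ≃ {x // x ∈ T} := Finset.equivOfCardEq (by rw [hS, hT.2])
    let τ : Equiv.Perm X := e.extendSubtype
    have hτ : S.map τ.toEmbedding = T := by
      apply Finset.eq_of_subset_of_card_le
      · intro x hx
        obtain ⟨y, hy, rfl⟩ := Finset.mem_map.1 hx
        exact e.extendSubtype_mem y hy
      · simp [hS, hT.2]
    refine Finset.card_le_card_of_injOn (fun π => π.trans τ) ?_ ?_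
    · intro π hπ
      simp only [hN, coe_filter, mem_univ, true_and, Set.mem_ofPred_eq] at hπ ⊢
      rw [← hτ, ← hπ, Finset.map_map]
      rfl
    · intro π _ π' _ h
      ext x
      have := congrArg (fun f => f x) h
      simpa using this
  have hsum : ∑ T ∈ powersetCard A.card (univ : Finset X), (N T).card ≤
      (Fintype.card X).factorial := by
    rw [← Fintype.card_perm, ← Finset.card_univ]
    rw [← Finset.card_biUnion]
    · exact Finset.card_le_card (Finset.subset_univ _)
    · intro T _ T' _ hTT'
      refine Finset.disjoint_left.2 fun π h h' => ?_
      simp only [hN, mem_filter, mem_univ, true_and] at h h'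
      exact hTT' (h.symm.trans h')
  calc _ ≤ (N S).card * (Fintype.card X).choose A.card :=
        Nat.mul_le_mul_right _ (Finset.card_le_card hsub)
    _ = ∑ T ∈ powersetCard A.card (univ : Finset X), (N S).card := by
        rw [Finset.sum_const, card_powersetCard, Finset.card_univ, smul_eq_mul, mul_comm]
    _ ≤ _ := (Finset.sum_le_sum hle).trans hsum

variable {G : Type} [AddCommGroup G] [DecidableEq G]

/-- The difference of the two indicator functions has values in `{-1, 0, 1}`. Apart from passing to
subsets, dissociation is used only in this form. -/
theorem IsDissociated.eq_of_sum_sub_eq {D : Finset G} (hD : IsDissociated D) {S T : Finset G}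
    (hS : S ⊆ D) (hT : T ⊆ D) (h : ∑ x ∈ S, x = ∑ x ∈ T, x) : S = T := by
  have key := hD (fun x => (if x ∈ S then 1 else 0) - (if x ∈ T then 1 else 0)) (by
    intro d _
    split_ifs <;> simp) (by
    simp only [sub_smul, Finset.sum_sub_distrib, ite_smul, one_smul, zero_smul]
    rw [← Finset.sum_filter, ← Finset.sum_filter, Finset.filter_mem_eq_inter,
      Finset.filter_mem_eq_inter, Finset.inter_eq_right.2 hS, Finset.inter_eq_right.2 hT, h,
      sub_self])
  ext x
  by_cases hx : x ∈ D
  · have := key x hx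
    by_cases h1 : x ∈ S <;> by_cases h2 : x ∈ T <;> simp_all
  · exact ⟨fun h => absurd (hS h) hx, fun h => absurd (hT h) hx⟩

theorem IsDissociated.sum_ne_zero {D S : Finset G} (hD : IsDissociated D) (hS : S ⊆ D)
    (hne : S.Nonempty) : ∑ x ∈ S, x ≠ 0 := by
  intro h
  have := hD.eq_of_sum_sub_eq hS (Finset.empty_subset D) (by simpa using h)
  exact hne.ne_empty this

theorem IsDissociated.mono {D S : Finset G} (hD : IsDissociated D) (hS : S ⊆ D) :
    IsDissociated S := by
  intro ε hε h d hd
  have := hD (fun x => if x ∈ S then ε x else 0) (by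
    intro x _
    split_ifs with hx
    · exact hε x hx
    · simp) (by
    simp only [ite_smul, zero_smul]
    rw [← Finset.sum_filter, Finset.filter_mem_eq_inter, Finset.inter_eq_right.2 hS, h]) d (hS hd)
  simpa [hd] using this

/-- The sum of the image of `A ⊆ D` under a random permutation of the dissociated set `D` takes any
given value with probability at most `1 / C(|D|, |A|)`. -/
theorem IsDissociated.card_perm_mul_choose_le {D : Finset G} (hD : IsDissociated D) {A : Finset G}
    (hA : A ⊆ D) (c : G) :
    ((univ : Finset (Equiv.Perm {x // x ∈ D})).filter
      fun π => ∑ x ∈ A, Equiv.Perm.ofSubtype π x = c).card * D.card.choose A.card ≤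
      D.card.factorial := by
  classical
  have h := card_perm_filter_mul_choose_le (X := {x // x ∈ D}) (A.subtype (· ∈ D))
    (fun S => ∑ x ∈ S, (x : G) = c) (by
      intro S T hS hT
      have := hD.eq_of_sum_sub_eq (S := S.map (Function.Embedding.subtype _))
        (T := T.map (Function.Embedding.subtype _)) (fun x hx => by
          obtain ⟨y, _, rfl⟩ := Finset.mem_map.1 hx; exact y.2) (fun x hx => by
          obtain ⟨y, _, rfl⟩ := Finset.mem_map.1 hx; exact y.2) (by
          rw [Finset.sum_map, Finset.sum_map]
          exact hS.trans hT.symm)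
      exact Finset.map_injective _ this)
  have hcard : (A.subtype (· ∈ D)).card = A.card := by
    rw [Finset.card_subtype, Finset.filter_mem_eq_inter, Finset.inter_eq_left.2 hA]
  rw [hcard, Fintype.card_coe] at h
  convert h using 5 with π
  rw [Finset.sum_map]
  -- The general statement concerns subsets of the type of elements of `D`; `A` is transported there
  -- and back.
  have : A = (A.subtype (· ∈ D)).map (Function.Embedding.subtype _) := by
    rw [Finset.subtype_map, Finset.filter_mem_eq_inter, Finset.inter_eq_left.2 hA]
  conv_lhs => rw [this, Finset.sum_map]
  simp

/-! ### Averaging over a family of permutations of the sample space -/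

/-- Each `act π` is a weight-preserving bijection of `S`, so the weight of `E` equals that of its
preimage. Averaging over `π` and exchanging the sums, each `x` counts with the proportion of `π`
sending it into `E`, which is at most `1 / C`. No group structure on `Γ` is needed. -/
theorem averaging {X Γ : Type*} [Fintype Γ] [Nonempty Γ] (S : Finset X) (act : Γ → X → X)
    (hmaps : ∀ π, ∀ x ∈ S, act π x ∈ S) (hinj : ∀ π, Set.InjOn (act π) S)
    (g : X → ℝ) (hg0 : ∀ x ∈ S, 0 ≤ g x) (hg : ∀ π, ∀ x ∈ S, g (act π x) = g x)
    (E : X → Prop) [DecidablePred E] (C : ℝ)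
    (hE : ∀ x ∈ S, ((univ.filter fun π => E (act π x)).card : ℝ) * C ≤ Fintype.card Γ) :
    C * ∑ x ∈ S with E x, g x ≤ ∑ x ∈ S, g x := by
  have hre : ∀ π, ∑ x ∈ S with E x, g x = ∑ x ∈ S, if E (act π x) then g x else 0 := by
    intro π
    rw [Finset.sum_filter]
    refine (Finset.sum_bij (fun x _ => act π x) (hmaps π) (fun a ha b hb h => hinj π ha hb h)
      ?_ ?_).symm
    · intro y hy
      obtain ⟨x, hx, rfl⟩ := Finset.surj_on_of_inj_on_of_card_le (fun x _ => act π x) (hmaps π)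
        (fun a b ha hb h => hinj π ha hb h) le_rfl y hy
      exact ⟨x, hx, rfl⟩
    · intro x hx
      rw [hg π x hx]
  have hpos : (0 : ℝ) < Fintype.card Γ := by exact_mod_cast Fintype.card_pos
  refine le_of_mul_le_mul_left ?_ hpos
  calc (Fintype.card Γ : ℝ) * (C * ∑ x ∈ S with E x, g x)
      = C * ∑ _π : Γ, ∑ x ∈ S with E x, g x := by
        rw [Finset.sum_const, Finset.card_univ, nsmul_eq_mul]; ring
    _ = C * ∑ π : Γ, ∑ x ∈ S, (if E (act π x) then g x else 0) := by
        congr 1; exact Finset.sum_congr rfl fun π _ => hre π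
    _ = ∑ x ∈ S, g x * (((univ.filter fun π => E (act π x)).card : ℝ) * C) := by
        rw [Finset.sum_comm, Finset.mul_sum]
        refine Finset.sum_congr rfl fun x _ => ?_
        rw [← Finset.sum_filter, Finset.sum_const, nsmul_eq_mul]; ring
    _ ≤ ∑ x ∈ S, g x * Fintype.card Γ :=
        Finset.sum_le_sum fun x hx => mul_le_mul_of_nonneg_left (hE x hx) (hg0 x hx)
    _ = _ := by rw [← Finset.sum_mul, mul_comm]

/-! ### The local lemma -/

/-- Symmetric lopsided Lovász local lemma, for a nonnegative additive set function. -/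
theorem local_lemma {X ι : Type*} [DecidableEq ι] (m : Set X → ℝ) (hm0 : ∀ A, 0 ≤ m A)
    (hadd : ∀ A B, m A = m (A ∩ B) + m (A \ B)) (hpos : 0 < m Set.univ)
    (I : Finset ι) (A : ι → Set X) (nbr : ι → Finset ι) (d : ℕ) (q : ℝ) (hq : 0 ≤ q)
    (hd : ∀ i ∈ I, (nbr i).card ≤ d) (hd1 : 1 ≤ d) (hqd : 4 * q * d ≤ 1)
    (h : ∀ i ∈ I, ∀ S ⊆ I, Disjoint S (nbr i) →
      m (A i ∩ ⋂ l ∈ S, (A l)ᶜ) ≤ q * m (⋂ l ∈ S, (A l)ᶜ)) :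
    0 < m (⋂ l ∈ I, (A l)ᶜ) := by
  have hmono : ∀ {B C : Set X}, B ⊆ C → m B ≤ m C := by
    intro B C hBC
    have := hadd C B
    rw [Set.inter_eq_right.2 hBC] at this
    linarith [hm0 (C \ B)]
  have hq4 : 4 * q ≤ 1 := by
    have : (1 : ℝ) ≤ d := by exact_mod_cast hd1
    nlinarith
  -- Union bound inside `B`.
  have hremove : ∀ (T : Finset ι) (B : Set X),
      m B ≤ m (B ∩ ⋂ l ∈ T, (A l)ᶜ) + ∑ l ∈ T, m (A l ∩ B) := by
    intro T B
    induction T using Finset.induction_on with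
    | empty => simp
    | insert a T ha ih =>
      rw [Finset.sum_insert ha]
      have h1 := hadd (B ∩ ⋂ l ∈ T, (A l)ᶜ) (A a)
      have h2 : m ((B ∩ ⋂ l ∈ T, (A l)ᶜ) ∩ A a) ≤ m (A a ∩ B) :=
        hmono fun x hx => ⟨hx.2, hx.1.1⟩
      have h3 : (B ∩ ⋂ l ∈ T, (A l)ᶜ) \ A a = B ∩ ⋂ l ∈ insert a T, (A l)ᶜ := by
        ext x
        simp only [Set.mem_sdiff, Set.mem_inter_iff, Set.mem_iInter, Finset.mem_insert,
          Set.mem_compl_iff, forall_eq_or_imp]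
        tauto
      rw [h3] at h1
      linarith
  -- Strong induction on the number of avoided events: given that these are avoided, every event has
  -- conditional mass at most `2q`.
  have key : ∀ n : ℕ, ∀ S ⊆ I, S.card = n →
      0 < m (⋂ l ∈ S, (A l)ᶜ) ∧
        ∀ i ∈ I, m (A i ∩ ⋂ l ∈ S, (A l)ᶜ) ≤ 2 * q * m (⋂ l ∈ S, (A l)ᶜ) := by
    intro n
    induction n using Nat.strong_induction_on with
    | _ n ih =>
      intro S hSI hSn
      have hpS : 0 < m (⋂ l ∈ S, (A l)ᶜ) := by
        rcases S.eq_empty_or_nonempty with rfl | ⟨a, ha⟩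
        · simpa using hpos
        · have hlt : (S.erase a).card < n := hSn ▸ Finset.card_erase_lt_of_mem ha
          obtain ⟨h1, h2⟩ := ih _ hlt (S.erase a) ((Finset.erase_subset _ _).trans hSI) rfl
          have h3 := h2 a (hSI ha)
          have h4 := hadd (⋂ l ∈ S.erase a, (A l)ᶜ) (A a)
          rw [Set.inter_comm] at h4
          have h5 : (⋂ l ∈ S.erase a, (A l)ᶜ) \ A a = ⋂ l ∈ S, (A l)ᶜ := by
            conv_rhs => rw [← Finset.insert_erase ha]
            rw [Finset.set_biInter_insert, Set.sdiff_eq, Set.inter_comm]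
          rw [h5] at h4
          nlinarith
      refine ⟨hpS, fun i hi => ?_⟩
      by_cases hemp : (S ∩ nbr i) = ∅
      · have := h i hi S hSI (Finset.disjoint_iff_inter_eq_empty.2 hemp)
        nlinarith
      have hT : (S \ nbr i) ⊆ I := (Finset.sdiff_subset).trans hSI
      have hlt : (S \ nbr i).card < n := by
        have := Finset.card_sdiff_add_card_inter S (nbr i)
        have h0 : 0 < (S ∩ nbr i).card := Finset.card_pos.2 (Finset.nonempty_iff_ne_empty.2 hemp)
        omega
      obtain ⟨h1, h2⟩ := ih _ hlt _ hT rfl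
      set B := ⋂ l ∈ S \ nbr i, (A l)ᶜ with hB
      have hBS : (B ∩ ⋂ l ∈ S ∩ nbr i, (A l)ᶜ) = ⋂ l ∈ S, (A l)ᶜ := by
        conv_rhs => rw [← Finset.sdiff_union_inter S (nbr i)]
        rw [hB, Finset.set_biInter_inter]
      have h3 := hremove (S ∩ nbr i) B
      rw [hBS] at h3
      -- Given that the events of `S` outside `nbr i` are avoided, the at most `d` neighbours in `S`
      -- remove at most `2qd ≤ 1/2` of the mass. Hence the bound `q` for `A i` at most doubles.
      have h4 : ∑ l ∈ S ∩ nbr i, m (A l ∩ B) ≤ d * (2 * q * m B) := by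
        refine (Finset.sum_le_sum fun l hl =>
          h2 l (hSI (Finset.mem_of_mem_inter_left hl))).trans ?_
        rw [Finset.sum_const, nsmul_eq_mul]
        refine mul_le_mul_of_nonneg_right ?_ (by positivity)
        exact_mod_cast (Finset.card_le_card Finset.inter_subset_right).trans (hd i hi)
      have h5 : m (A i ∩ ⋂ l ∈ S, (A l)ᶜ) ≤ m (A i ∩ B) :=
        hmono (by rw [← hBS]; exact fun x hx => ⟨hx.1, hx.2.1⟩)
      have h6 := h i hi _ hT (Finset.sdiff_disjoint)
      have h7 : d * (2 * q * m B) ≤ m B / 2 := by nlinarith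
      have h8 : m B ≤ 2 * m (⋂ l ∈ S, (A l)ᶜ) := by linarith
      calc _ ≤ q * m B := h5.trans h6
        _ ≤ q * (2 * m (⋂ l ∈ S, (A l)ᶜ)) := mul_le_mul_of_nonneg_left h8 hq
        _ = _ := by ring
  exact (key _ I subset_rfl rfl).1

/-! ### Orderings, segments and quarterings -/

theorem mem_orderings {X : Finset G} {l : List G} :
    l ∈ orderings X ↔ l.Nodup ∧ l.toFinset = X := by
  rw [orderings, Multiset.mem_toFinset, Multiset.mem_lists_iff]
  constructor
  · intro h
    have hn : l.Nodup := by
      have := X.nodup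
      rw [h] at this
      exact Multiset.coe_nodup.1 this
    refine ⟨hn, ?_⟩
    ext x
    rw [List.mem_toFinset, ← Finset.mem_val, h]
    exact Multiset.mem_coe.symm
  · rintro ⟨h1, rfl⟩
    rw [List.toFinset_val, List.dedup_eq_self.2 h1]
    rfl

theorem length_of_mem_orderings {X : Finset G} {l : List G} (h : l ∈ orderings X) :
    l.length = X.card := by
  obtain ⟨h1, rfl⟩ := mem_orderings.1 h
  rw [List.toFinset_card_of_nodup h1]

theorem orderings_nonempty (X : Finset G) : (orderings X).Nonempty :=
  ⟨X.toList, mem_orderings.2 ⟨X.nodup_toList, X.toList_toFinset⟩⟩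

theorem map_mem_orderings {X : Finset G} {l : List G} (h : l ∈ orderings X) (e : Equiv.Perm G) :
    l.map e ∈ orderings (X.map e.toEmbedding) := by
  obtain ⟨h1, rfl⟩ := mem_orderings.1 h
  refine mem_orderings.2 ⟨h1.map e.injective, ?_⟩
  ext x
  simp [← Equiv.eq_symm_apply]

theorem segment_map (l : List G) (a : Fin 4) (e : Equiv.Perm G) :
    segment (l.map e) a = (segment l a).map e := by
  simp [segment, List.map_take, List.map_drop]

theorem segment_append {l : List G} (h : 4 ∣ l.length) :
    segment l 0 ++ (segment l 1 ++ (segment l 2 ++ segment l 3)) = l := by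
  obtain ⟨m, hm⟩ := h
  have h4 : l.length / 4 = m := by omega
  have h3 : (l.drop (3 * m)).take m = l.drop (3 * m) :=
    List.take_of_length_le (by rw [List.length_drop]; omega)
  have step : ∀ c, (l.drop (c * m)).take m ++ l.drop ((c + 1) * m) = l.drop (c * m) := by
    intro c
    have := List.take_append_drop m (l.drop (c * m))
    rwa [List.drop_drop, show c * m + m = (c + 1) * m by ring] at this
  have e0 := step 0
  have e1 := step 1
  have e2 := step 2
  simp only [zero_mul, List.drop_zero, zero_add, one_mul, show 1 + 1 = 2 from rfl,
    show 2 + 1 = 3 from rfl] at e0 e1 e2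
  simp only [segment, h4, Fin.val_zero, Fin.val_one, Fin.val_two,
    show ((3 : Fin 4) : ℕ) = 3 from rfl]
  rw [h3]
  simp only [zero_mul, List.drop_zero, one_mul]
  rw [e2, e1, e0]

theorem length_segment {l : List G} (h : 4 ∣ l.length) (a : Fin 4) :
    (segment l a).length = l.length / 4 := by
  obtain ⟨m, hm⟩ := h
  have h4 : l.length / 4 = m := by omega
  rw [segment, h4, List.length_take, List.length_drop, hm]
  have : (a : ℕ) < 4 := a.isLt
  rw [min_eq_left]
  interval_cases h : (a : ℕ) <;> omega

theorem nodup_segment {l : List G} (h : l.Nodup) (a : Fin 4) : (segment l a).Nodup :=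
  (h.sublist (List.drop_sublist _ _)).sublist (List.take_sublist _ _)

theorem mem_quarterings {X : Finset G} {P : Fin 4 → Finset G} :
    P ∈ quarterings X ↔ (∀ a b, a ≠ b → Disjoint (P a) (P b)) ∧
      (∀ a, (P a).card = X.card / 4) ∧ Finset.univ.biUnion P = X := by
  classical
  rw [quarterings, Finset.mem_filter, Fintype.mem_piFinset]
  constructor
  · rintro ⟨_, h1, h2, h3⟩
    exact ⟨h1, h2, by convert h3⟩
  · rintro ⟨h1, h2, h3⟩
    refine ⟨fun a => ?_, h1, h2, by convert h3⟩
    rw [Finset.mem_powerset, ← h3]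
    exact Finset.subset_biUnion_of_mem P (Finset.mem_univ a)

theorem segment_mem_quarterings {X : Finset G} (hX : 4 ∣ X.card) {l : List G}
    (hl : l ∈ orderings X) : (fun a => (segment l a).toFinset) ∈ quarterings X := by
  have hlen := length_of_mem_orderings hl
  obtain ⟨hn, rfl⟩ := mem_orderings.1 hl
  rw [← hlen] at hX
  have happ := segment_append hX
  have hn' := hn
  rw [← happ] at hn'
  simp only [List.nodup_append', List.disjoint_append_right] at hn'
  obtain ⟨-, ⟨-, ⟨-, -, d23⟩, d12, d13⟩, d01, d02, d03⟩ := hn'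
  refine mem_quarterings.2 ⟨?_, ?_, ?_⟩
  · intro a b hab
    rw [List.disjoint_toFinset_iff_disjoint]
    fin_cases a <;> fin_cases b <;>
      first | exact absurd rfl hab | assumption | (apply List.Disjoint.symm; assumption)
  · intro a
    rw [List.toFinset_card_of_nodup (nodup_segment hn a), length_segment hX, hlen]
  · conv_rhs => rw [← happ]
    ext x
    simp [Fin.exists_fin_succ]

theorem quarterings_nonempty {X : Finset G} (hX : 4 ∣ X.card) : (quarterings X).Nonempty :=
  let ⟨_, hl⟩ := orderings_nonempty X
  ⟨_, segment_mem_quarterings hX hl⟩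

theorem map_mem_quarterings {X : Finset G} {P : Fin 4 → Finset G} (h : P ∈ quarterings X)
    (e : Equiv.Perm G) : (fun a => (P a).map e.toEmbedding) ∈ quarterings (X.map e.toEmbedding) := by
  obtain ⟨h1, h2, h3⟩ := mem_quarterings.1 h
  refine mem_quarterings.2 ⟨fun a b hab => (Finset.disjoint_map _).2 (h1 a b hab), ?_, ?_⟩
  · intro a
    rw [Finset.card_map, Finset.card_map, h2 a]
  · rw [← h3]
    ext x
    simp

/-! ### The blocks -/

variable {r : ℕ}

theorem blockSet_val (q : Fin (4 * (r + 2))) : (blockSet q).val =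
    if q.val < 2 * (r + 2) then q.val / 2 else (q.val - 2 * (r + 2)) / 2 := by
  have := q.isLt
  simp only [blockSet]
  split_ifs with h
  · rw [Nat.mod_eq_of_lt h]
  · rw [Nat.mod_eq_sub_mod (by omega), Nat.mod_eq_of_lt (by omega)]

theorem blockPart_val (q : Fin (4 * (r + 2))) : (blockPart q).val =
    if q.val < 2 * (r + 2) then q.val % 2 else 2 + q.val % 2 := by
  have := q.isLt
  simp only [blockPart]
  split_ifs with h
  · rw [Nat.div_eq_of_lt h]; omega
  · have : q.val / (2 * (r + 2)) = 1 := by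
      rw [Nat.div_eq_iff (by omega)]; omega
    rw [this]

/-- The blocks are in bijection with the pairs of a set and a part of it. -/
def blockEquiv : Fin (4 * (r + 2)) ≃ Fin (r + 2) × Fin 4 :=
  Equiv.ofBijective (fun q => (blockSet q, blockPart q)) (by
    constructor
    · intro q q' h
      simp only [Prod.mk.injEq, Fin.ext_iff, blockSet_val, blockPart_val] at h
      have := q.isLt
      have := q'.isLt
      ext
      split_ifs at h <;> omega
    · rintro ⟨j, a⟩
      have hj := j.isLt
      have ha := a.isLt
      by_cases h : a.val < 2
      · refine ⟨⟨2 * j + a, by omega⟩, ?_⟩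
        simp only [Prod.mk.injEq, Fin.ext_iff, blockSet_val, blockPart_val]
        rw [if_pos (by omega), if_pos (by omega)]
        omega
      · refine ⟨⟨2 * (r + 2) + 2 * j + (a - 2), by omega⟩, ?_⟩
        simp only [Prod.mk.injEq, Fin.ext_iff, blockSet_val, blockPart_val]
        rw [if_neg (by omega), if_neg (by omega)]
        omega)

theorem blockSet_symm (j : Fin (r + 2)) (a : Fin 4) : blockSet (blockEquiv.symm (j, a)) = j :=
  congrArg Prod.fst (blockEquiv.apply_symm_apply (j, a))

theorem blockPart_symm (j : Fin (r + 2)) (a : Fin 4) : blockPart (blockEquiv.symm (j, a)) = a :=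
  congrArg Prod.snd (blockEquiv.apply_symm_apply (j, a))

/-- `q` or the other member of its pair of adjacent blocks is a part of `D j`. -/
def Touches (j : Fin (r + 2)) (q : Fin (4 * (r + 2))) : Prop :=
  blockSet q = j ∨ ∃ q' : Fin (4 * (r + 2)), blockSet q' = j ∧
    ((q.val % 2 = 1 ∧ q'.val = q.val + 1) ∨ (q'.val % 2 = 1 ∧ q.val = q'.val + 1))

/-- Both blocks of a constrained pair touch `D j` or neither does, so the permissibility constraints
split cleanly into those near `D j` and those away from it. -/
theorem touches_iff_of_pair {j : Fin (r + 2)} {q q' : Fin (4 * (r + 2))} (h : q.val % 2 = 1)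
    (h' : q'.val = q.val + 1) : Touches j q ↔ Touches j q' := by
  have key : ∀ x : Fin (4 * (r + 2)), x.val = q.val + 1 → x = q' := fun x hx => by ext; omega
  have key' : ∀ x : Fin (4 * (r + 2)), q'.val = x.val + 1 → x = q := fun x hx => by ext; omega
  constructor
  · rintro (h1 | ⟨x, hx, ⟨_, h2⟩ | ⟨h2, h3⟩⟩)
    · exact Or.inr ⟨q, h1, Or.inr ⟨h, h'⟩⟩
    · exact Or.inl (key x h2 ▸ hx)
    · omega
  · rintro (h1 | ⟨x, hx, ⟨h2, _⟩ | ⟨h2, h3⟩⟩)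
    · exact Or.inr ⟨q', h1, Or.inl ⟨h, h'⟩⟩
    · omega
    · exact Or.inl (key' x h3 ▸ hx)

open Classical in
theorem card_touches_le (j : Fin (r + 2)) :
    ((univ : Finset (Fin (4 * (r + 2)))).filter (Touches j)).card ≤ 8 := by
  -- In each half of the block order, the two parts of `D j` at `2j, 2j+1` and their partners occupy
  -- `2j-1, …, 2j+2`. The shift by one avoids a truncated subtraction at `j = 0`.
  have hsub : ((univ : Finset (Fin (4 * (r + 2)))).filter (Touches j)).image (fun q => q.val + 1) ⊆
      {2 * j.val, 2 * j.val + 1, 2 * j.val + 2, 2 * j.val + 3, 2 * (r + 2) + 2 * j.val,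
        2 * (r + 2) + 2 * j.val + 1, 2 * (r + 2) + 2 * j.val + 2,
        2 * (r + 2) + 2 * j.val + 3} := by
    intro x hx
    obtain ⟨q, hq, rfl⟩ := Finset.mem_image.1 hx
    have h := (Finset.mem_filter.1 hq).2
    simp only [Finset.mem_insert, Finset.mem_singleton]
    rcases h with h | ⟨q', h, h2⟩
    · have hj := congrArg Fin.val h
      rw [blockSet_val] at hj
      have := q.isLt
      split_ifs at hj <;> omega
    · have hj := congrArg Fin.val h
      rw [blockSet_val] at hj
      have := q.isLt
      have := q'.isLt
      split_ifs at hj <;> omega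
  have hcard := Finset.card_le_card hsub
  rw [Finset.card_image_of_injective _ (fun a b h => Fin.ext (by simpa using h))] at hcard
  refine hcard.trans ?_
  repeat refine (Finset.card_insert_le _ _).trans (Nat.succ_le_succ ?_)
  simp

theorem mem_splits {D : Fin (r + 2) → Finset G} {w : Split G r} :
    w ∈ splits D ↔ w.1 ∈ orderings (D 0) ∧ w.2.1 ∈ orderings (D (Fin.last (r + 1))) ∧
      ∀ i : Fin r, w.2.2 i ∈ quarterings (D i.castSucc.succ) := by
  rw [splits, Finset.mem_product, Finset.mem_product, Fintype.mem_piFinset]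

theorem splits_nonempty {D : Fin (r + 2) → Finset G} (h4 : ∀ j, 4 ∣ (D j).card) :
    (splits D).Nonempty :=
  (orderings_nonempty _).product ((orderings_nonempty _).product
    (Fintype.piFinset_nonempty.2 fun _ => quarterings_nonempty (h4 _)))

theorem parts_zero (w : Split G r) : parts w 0 = fun a => (segment w.1 a).toFinset := rfl

theorem parts_last (w : Split G r) :
    parts w (Fin.last (r + 1)) = fun a => (segment w.2.1 a).toFinset := by
  rw [parts, ← Fin.succ_last, Fin.cons_succ, Fin.snoc_last]

theorem parts_middle (w : Split G r) (i : Fin r) : parts w i.castSucc.succ = w.2.2 i := by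
  rw [parts, Fin.cons_succ, Fin.snoc_castSucc]

theorem fin_cases_ends {P : Fin (r + 2) → Prop} (h0 : P 0) (hl : P (Fin.last (r + 1)))
    (hm : ∀ i : Fin r, P i.castSucc.succ) (j : Fin (r + 2)) : P j := by
  refine Fin.cases h0 (fun i => ?_) j
  refine Fin.lastCases ?_ (fun i => hm i) i
  rw [Fin.succ_last]; exact hl

theorem parts_mem_quarterings {D : Fin (r + 2) → Finset G} (h4 : ∀ j, 4 ∣ (D j).card)
    {w : Split G r} (hw : w ∈ splits D) (j : Fin (r + 2)) : parts w j ∈ quarterings (D j) := by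
  obtain ⟨h1, h2, h3⟩ := mem_splits.1 hw
  refine fin_cases_ends (P := fun j => parts w j ∈ quarterings (D j)) ?_ ?_ ?_ j
  · exact segment_mem_quarterings (h4 0) h1
  · rw [parts_last]; exact segment_mem_quarterings (h4 _) h2
  · intro i; rw [parts_middle]; exact h3 i

section
variable {D : Fin (r + 2) → Finset G} (h4 : ∀ j, 4 ∣ (D j).card) {w : Split G r}
  (hw : w ∈ splits D)
include h4 hw

theorem card_block (q : Fin (4 * (r + 2))) : (block w q).card = blockSize D q :=
  (mem_quarterings.1 (parts_mem_quarterings h4 hw (blockSet q))).2.1 (blockPart q)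

theorem block_subset (q : Fin (4 * (r + 2))) : block w q ⊆ D (blockSet q) := by
  rw [← (mem_quarterings.1 (parts_mem_quarterings h4 hw (blockSet q))).2.2]
  exact Finset.subset_biUnion_of_mem (parts w (blockSet q)) (Finset.mem_univ (blockPart q))

theorem block_disjoint {q q' : Fin (4 * (r + 2))} (h : blockSet q = blockSet q') (hne : q ≠ q') :
    Disjoint (block w q) (block w q') := by
  have := (mem_quarterings.1 (parts_mem_quarterings h4 hw (blockSet q))).1 (blockPart q)
    (blockPart q') (fun h' => hne (blockEquiv.injective (Prod.ext h h')))
  rw [block, block, ← h]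
  exact this

theorem sum_blocks (j : Fin (r + 2)) :
    ∑ q with blockSet q = j, ∑ x ∈ block w q, x = ∑ x ∈ D j, x := by
  obtain ⟨h1, h2, h3⟩ := mem_quarterings.1 (parts_mem_quarterings h4 hw j)
  rw [← h3, Finset.sum_biUnion (fun a _ b _ hab => h1 a b hab), Finset.sum_filter,
    ← Equiv.sum_comp blockEquiv.symm, Fintype.sum_prod_type, Finset.sum_eq_single j]
  · refine Finset.sum_congr rfl fun a _ => ?_
    rw [block, blockSet_symm, blockPart_symm, if_pos rfl]
  · intro j' _ hne
    refine Finset.sum_eq_zero fun a _ => ?_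
    rw [blockSet_symm, if_neg hne]
  · simp

end

theorem sum_blockSize {D : Fin (r + 2) → Finset G} (h4 : ∀ j, 4 ∣ (D j).card) (j : Fin (r + 2)) :
    ∑ q with blockSet q = j, blockSize D q = (D j).card := by
  rw [Finset.sum_filter, ← Equiv.sum_comp blockEquiv.symm, Fintype.sum_prod_type,
    Finset.sum_eq_single j]
  · simp only [blockSize, blockSet_symm, if_true, Finset.sum_const, Finset.card_univ, Fintype.card_fin,
      smul_eq_mul]
    have := h4 j
    omega
  · intro j' _ hne
    refine Finset.sum_eq_zero fun a _ => ?_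
    rw [blockSet_symm, if_neg hne]
  · simp

theorem sum_all_blockSize {D : Fin (r + 2) → Finset G} (h4 : ∀ j, 4 ∣ (D j).card) :
    ∑ q, blockSize D q = ∑ j, (D j).card := by
  rw [← Finset.sum_fiberwise univ (fun q : Fin (4 * (r + 2)) => blockSet q)]
  exact Finset.sum_congr rfl fun j _ => sum_blockSize h4 j

/-! ### Permuting the elements -/

/-- The image of a splitting under a permutation of the group elements. -/
def Split.map (e : Equiv.Perm G) (w : Split G r) : Split G r :=
  (w.1.map e, w.2.1.map e, fun i a => (w.2.2 i a).map e.toEmbedding)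

theorem parts_map (e : Equiv.Perm G) (w : Split G r) (j : Fin (r + 2)) (a : Fin 4) :
    parts (Split.map e w) j a = (parts w j a).map e.toEmbedding := by
  have key : ∀ l : List G, (l.map e).toFinset = l.toFinset.map e.toEmbedding := by
    intro l; ext x; simp [← Equiv.eq_symm_apply]
  refine fin_cases_ends
    (P := fun j => parts (Split.map e w) j a = (parts w j a).map e.toEmbedding) ?_ ?_ ?_ j
  · simp only [parts_zero, Split.map, segment_map, key]
  · simp only [parts_last, Split.map, segment_map, key]
  · intro i; simp only [parts_middle, Split.map]

theorem block_map (e : Equiv.Perm G) (w : Split G r) (q : Fin (4 * (r + 2))) :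
    block (Split.map e w) q = (block w q).map e.toEmbedding := parts_map e w _ _

theorem map_mem_splits {D : Fin (r + 2) → Finset G} {e : Equiv.Perm G}
    (he : ∀ j, (D j).map e.toEmbedding = D j) {w : Split G r} (hw : w ∈ splits D) :
    Split.map e w ∈ splits D := by
  obtain ⟨h1, h2, h3⟩ := mem_splits.1 hw
  refine mem_splits.2 ⟨?_, ?_, fun i => ?_⟩
  · have := map_mem_orderings h1 e
    rwa [he] at this
  · have := map_mem_orderings h2 e
    rwa [he] at this
  · have := map_mem_quarterings (h3 i) e
    rwa [he] at this

theorem split_map_map (e e' : Equiv.Perm G) (w : Split G r) :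
    Split.map e (Split.map e' w) = Split.map (e * e') w := by
  simp only [Split.map, List.map_map, Finset.map_map]
  rfl

theorem split_map_one (w : Split G r) : Split.map 1 w = w := by
  obtain ⟨a, b, c⟩ := w
  simp only [Split.map, Equiv.Perm.coe_one, List.map_id]
  congr
  funext i a
  exact Finset.map_refl

theorem map_ofSubtype_self (D : Finset G) (π : Equiv.Perm {x // x ∈ D}) :
    D.map (Equiv.Perm.ofSubtype π).toEmbedding = D := by
  apply Finset.eq_of_subset_of_card_le
  · intro x hx
    obtain ⟨y, hy, rfl⟩ := Finset.mem_map.1 hx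
    exact (Equiv.Perm.ofSubtype_apply_mem_iff_mem π y).2 hy
  · simp

theorem map_ofSubtype_of_disjoint {D X : Finset G} (h : Disjoint X D)
    (π : Equiv.Perm {x // x ∈ D}) : X.map (Equiv.Perm.ofSubtype π).toEmbedding = X := by
  apply Finset.eq_of_subset_of_card_le
  · intro x hx
    obtain ⟨y, hy, rfl⟩ := Finset.mem_map.1 hx
    rw [Equiv.coe_toEmbedding, Equiv.Perm.ofSubtype_apply_of_not_mem π
      (Finset.disjoint_left.1 h hy)]
    exact hy
  · simp

theorem list_map_ofSubtype_of_disjoint {D : Finset G} {l : List G} (h : Disjoint l.toFinset D)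
    (π : Equiv.Perm {x // x ∈ D}) : l.map (Equiv.Perm.ofSubtype π) = l := by
  conv_rhs => rw [← List.map_id l]
  refine List.map_congr_left fun x hx => ?_
  rw [Equiv.Perm.ofSubtype_apply_of_not_mem π
    (Finset.disjoint_left.1 h (List.mem_toFinset.2 hx)), id]

/-! ### Permissible orders -/

/-- Union bound over the `K²` pairs of lengths. For each, the last `i` entries of the permuted list
must sum to a prescribed value, which has probability at most `1 / C(|T|, i) ≤ 1 / |T|`, since `1 ≤
i < |T|`. -/
theorem card_perm_not_permissible {T : Finset G} (hT : IsDissociated T) {K : ℕ} (hK : K < T.card)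
    {l : List G} (hl : l ∈ orderings T) (l' : List G)
    [DecidablePred fun π : Equiv.Perm {x // x ∈ T} =>
      ¬ IsPermissible K (l.map (Equiv.Perm.ofSubtype π)) l'] :
    ((univ : Finset (Equiv.Perm {x // x ∈ T})).filter fun π =>
      ¬ IsPermissible K (l.map (Equiv.Perm.ofSubtype π)) l').card * T.card ≤
      K ^ 2 * T.card.factorial := by
  classical
  have hlen := length_of_mem_orderings hl
  obtain ⟨hn, hTl⟩ := mem_orderings.1 hl
  set F : ℕ × ℕ → Finset (Equiv.Perm {x // x ∈ T}) := fun h => univ.filter fun π =>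
    ∑ x ∈ (l.reverse.take h.1).toFinset, Equiv.Perm.ofSubtype π x = -(l'.take h.2).sum with hF
  have hsub : (univ.filter fun π : Equiv.Perm {x // x ∈ T} =>
      ¬ IsPermissible K (l.map (Equiv.Perm.ofSubtype π)) l') ⊆
      (Finset.Icc 1 K ×ˢ Finset.Icc 1 K).biUnion F := by
    intro π hπ
    have hπ := (Finset.mem_filter.1 hπ).2
    simp only [IsPermissible, not_forall, not_not] at hπ
    obtain ⟨i, j, h1, h2, h3, h4, h5⟩ := hπ
    refine Finset.mem_biUnion.2 ⟨(i, j), ?_, ?_⟩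
    · simp only [Finset.mem_product, Finset.mem_Icc]; exact ⟨⟨h1, h2⟩, h3, h4⟩
    · refine Finset.mem_filter.2 ⟨Finset.mem_univ _, ?_⟩
      rw [List.sum_toFinset _ ((List.nodup_reverse.2 hn).sublist (List.take_sublist _ _)),
        List.map_take, List.map_reverse]
      exact eq_neg_of_add_eq_zero_left h5
  have hone : ∀ h ∈ Finset.Icc 1 K ×ˢ Finset.Icc 1 K, (F h).card * T.card ≤ T.card.factorial := by
    intro h hh
    simp only [Finset.mem_product, Finset.mem_Icc] at hh
    have hA : (l.reverse.take h.1).toFinset ⊆ T := by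
      rw [← hTl]
      intro x hx
      rw [List.mem_toFinset] at hx ⊢
      exact List.mem_reverse.1 (List.mem_of_mem_take hx)
    have hcard : (l.reverse.take h.1).toFinset.card = h.1 := by
      rw [List.toFinset_card_of_nodup
        ((List.nodup_reverse.2 hn).sublist (List.take_sublist _ _)), List.length_take,
        List.length_reverse]
      omega
    have := hT.card_perm_mul_choose_le hA (-(l'.take h.2).sum)
    rw [hcard] at this
    exact (Nat.mul_le_mul_left _ (le_choose_of_between hh.1.1 (by omega))).trans this
  calc _ ≤ (∑ h ∈ Finset.Icc 1 K ×ˢ Finset.Icc 1 K, (F h).card) * T.card :=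
        Nat.mul_le_mul_right _ ((Finset.card_le_card hsub).trans Finset.card_biUnion_le)
    _ = ∑ h ∈ Finset.Icc 1 K ×ˢ Finset.Icc 1 K, (F h).card * T.card := Finset.sum_mul _ _ _
    _ ≤ ∑ h ∈ Finset.Icc 1 K ×ˢ Finset.Icc 1 K, T.card.factorial := Finset.sum_le_sum hone
    _ = _ := by
      rw [Finset.sum_const, Finset.card_product, Nat.card_Icc, smul_eq_mul, Nat.add_sub_cancel,
        sq]

theorem exists_permissible {T : Finset G} (hT : IsDissociated T) {K : ℕ} (hK : K ^ 2 < T.card)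
    (l' : List G) : ∃ l ∈ orderings T, IsPermissible K l l' := by
  classical
  obtain ⟨l, hl⟩ := orderings_nonempty T
  by_contra! hcon
  have h := card_perm_not_permissible hT (K := K) (by nlinarith) hl l'
  rw [Finset.filter_true_of_mem] at h
  · rw [Finset.card_univ, Fintype.card_perm, Fintype.card_coe, mul_comm] at h
    have := Nat.le_of_mul_le_mul_right h (Nat.factorial_pos _)
    omega
  · intro π _
    apply hcon
    have := map_mem_orderings hl (Equiv.Perm.ofSubtype π)
    rwa [map_ofSubtype_self] at this

/-! ### Arrangements with some of the permissibility constraints -/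

open Classical in
/-- As `arrangements`, but permissibility is required only for the pairs of blocks `(q, q + 1)`
for which `M q` holds. -/
def arrangementsOn (K : ℕ) (w : Split G r) (M : Fin (4 * (r + 2)) → Prop) :
    Finset (Fin (4 * (r + 2)) → List G) :=
  (Fintype.piFinset fun q => orderings (block w q)).filter fun b =>
    (∀ q, q.val = 0 → b q = segment w.1 0) ∧
    (∀ q, q.val + 1 = 4 * (r + 2) → b q = segment w.2.1 3) ∧
    ∀ q q', q.val % 2 = 1 → q'.val = q.val + 1 → M q → IsPermissible K (b q) (b q')

theorem mem_arrangementsOn {K : ℕ} {w : Split G r} {M : Fin (4 * (r + 2)) → Prop}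
    {b : Fin (4 * (r + 2)) → List G} : b ∈ arrangementsOn K w M ↔
      (∀ q, b q ∈ orderings (block w q)) ∧ (∀ q, q.val = 0 → b q = segment w.1 0) ∧
      (∀ q, q.val + 1 = 4 * (r + 2) → b q = segment w.2.1 3) ∧
      ∀ q q', q.val % 2 = 1 → q'.val = q.val + 1 → M q → IsPermissible K (b q) (b q') := by
  simp only [arrangementsOn, Finset.mem_filter, Fintype.mem_piFinset]

theorem arrangements_eq (K : ℕ) (w : Split G r) :
    arrangements K w = arrangementsOn K w fun _ => True := by
  ext b
  simp only [arrangements, mem_arrangementsOn, Finset.mem_filter, Fintype.mem_piFinset,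
    true_imp_iff]

theorem arrangementsOn_mono {K : ℕ} {w : Split G r} {M M' : Fin (4 * (r + 2)) → Prop}
    (h : ∀ q, M q → M' q) : arrangementsOn K w M' ⊆ arrangementsOn K w M := by
  intro b hb
  rw [mem_arrangementsOn] at hb ⊢
  exact ⟨hb.1, hb.2.1, hb.2.2.1, fun q q' h1 h2 h3 => hb.2.2.2 q q' h1 h2 (h q h3)⟩

theorem block_first {w : Split G r} {q : Fin (4 * (r + 2))} (hq : q.val = 0) :
    block w q = (segment w.1 0).toFinset := by
  have h1 : blockSet q = 0 := by
    ext; rw [blockSet_val, hq]; simp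
  have h2 : blockPart q = 0 := by
    ext; rw [blockPart_val, hq]; simp
  rw [block, h1, h2, parts_zero]

theorem block_last {w : Split G r} {q : Fin (4 * (r + 2))} (hq : q.val + 1 = 4 * (r + 2)) :
    block w q = (segment w.2.1 3).toFinset := by
  have h1 : blockSet q = Fin.last (r + 1) := by
    ext; rw [blockSet_val, if_neg (by omega), Fin.val_last]; omega
  have h2 : blockPart q = 3 := by
    ext; rw [blockPart_val, if_neg (by omega), show ((3 : Fin 4) : ℕ) = 3 from rfl]; omega
  rw [block, h1, h2, parts_last]

theorem segment_first_mem {D : Fin (r + 2) → Finset G} {w : Split G r} (hw : w ∈ splits D)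
    {q : Fin (4 * (r + 2))} (hq : q.val = 0) : segment w.1 0 ∈ orderings (block w q) :=
  mem_orderings.2 ⟨nodup_segment (mem_orderings.1 (mem_splits.1 hw).1).1 0, (block_first hq).symm⟩

theorem segment_last_mem {D : Fin (r + 2) → Finset G} {w : Split G r} (hw : w ∈ splits D)
    {q : Fin (4 * (r + 2))} (hq : q.val + 1 = 4 * (r + 2)) :
    segment w.2.1 3 ∈ orderings (block w q) :=
  mem_orderings.2 ⟨nodup_segment (mem_orderings.1 (mem_splits.1 hw).2.1).1 3,
    (block_last hq).symm⟩

section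
variable {D : Fin (r + 2) → Finset G} (hD : ∀ j, IsDissociated (D j)) (h4 : ∀ j, 4 ∣ (D j).card)
  {w : Split G r} (hw : w ∈ splits D) {K : ℕ}
include hD h4 hw

theorem arrangements_nonempty (hK : ∀ q, K ^ 2 < blockSize D q) : (arrangements K w).Nonempty := by
  classical
  let base : Fin (4 * (r + 2)) → List G := fun q =>
    if q.val = 0 then segment w.1 0 else if q.val + 1 = 4 * (r + 2) then segment w.2.1 3 else
      (block w q).toList
  have hbase : ∀ q, base q ∈ orderings (block w q) := by
    intro q
    simp only [base]
    split_ifs with h1 h2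
    · exact segment_first_mem hw h1
    · exact segment_last_mem hw h2
    · exact mem_orderings.2 ⟨Finset.nodup_toList _, Finset.toList_toFinset _⟩
  have hex : ∀ (q : Fin (4 * (r + 2))) (l' : List G),
      ∃ l ∈ orderings (block w q), IsPermissible K l l' := fun q l' =>
    exists_permissible ((hD _).mono (block_subset h4 hw q)) (by rw [card_block h4 hw]; exact hK q) l'
  choose f hf1 hf2 using hex
  -- The constrained pairs are disjoint, so the second block of each pair is ordered in advance and
  -- the first is then chosen against it. The last block has odd index but no successor, and keeps
  -- its prescribed order.
  refine ⟨fun q => if h : q.val % 2 = 1 ∧ q.val + 1 < 4 * (r + 2) then f q (base ⟨q.val + 1, h.2⟩)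
    else base q, ?_⟩
  rw [arrangements_eq, mem_arrangementsOn]
  refine ⟨fun q => ?_, fun q hq => ?_, fun q hq => ?_, fun q q' h1 h2 _ => ?_⟩
  · split_ifs
    · exact hf1 _ _
    · exact hbase q
  · rw [dif_neg (by omega)]
    exact if_pos hq
  · rw [dif_neg (by omega)]
    simp only [base]
    rw [if_neg (by omega), if_pos hq]
  · have := q'.isLt
    rw [dif_pos ⟨h1, by omega⟩, dif_neg (by omega)]
    have hq' : (⟨q.val + 1, by omega⟩ : Fin (4 * (r + 2))) = q' := Fin.ext h2.symm
    rw [hq']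
    exact hf2 _ _

/-- Averaging over permutations of block `q` alone. Being odd with a successor, `q` is not an end
block, and its only possible constraint is with `q'`, which is not imposed; so these permutations
preserve the arrangements. -/
theorem card_not_permissible {M : Fin (4 * (r + 2)) → Prop} {q q' : Fin (4 * (r + 2))}
    (hq : q.val % 2 = 1) (hq' : q'.val = q.val + 1) (hM : ¬ M q) (hK : K < blockSize D q)
    [DecidablePred fun b : (Fin (4 * (r + 2)) → List G) => ¬ IsPermissible K (b q) (b q')] :
    ((arrangementsOn K w M).filter fun b : Fin (4 * (r + 2)) → List G =>
      ¬ IsPermissible K (b q) (b q')).card * blockSize D q ≤ K ^ 2 * (arrangementsOn K w M).card := by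
  classical
  have hT := (hD _).mono (block_subset h4 hw q)
  have hcard := card_block h4 hw q
  rcases Nat.eq_zero_or_pos K with rfl | hKpos
  · rw [Finset.filter_false_of_mem]
    · simp
    · intro b _ h
      exact h fun i j h1 h2 => by omega
  have hqq' : q' ≠ q := fun h => by rw [h] at hq'; omega
  have key := averaging (Γ := Equiv.Perm {x // x ∈ block w q}) (arrangementsOn K w M)
    (fun π b => Function.update b q ((b q).map (Equiv.Perm.ofSubtype π))) (by
      intro π b hb
      rw [mem_arrangementsOn] at hb ⊢
      obtain ⟨h1, h2, h3, h4⟩ := hb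
      refine ⟨fun x => ?_, fun x hx => ?_, fun x hx => ?_, fun x y hx hy hMx => ?_⟩
      · by_cases hxq : x = q
        · subst hxq
          have := map_mem_orderings (h1 x) (Equiv.Perm.ofSubtype π)
          rw [map_ofSubtype_self] at this
          simpa using this
        · rw [Function.update_of_ne hxq]; exact h1 x
      · rw [Function.update_of_ne (by rintro rfl; omega)]; exact h2 x hx
      · rw [Function.update_of_ne (by have := q'.isLt; rintro rfl; omega)]; exact h3 x hx
      · rw [Function.update_of_ne (by rintro rfl; exact hM hMx),
          Function.update_of_ne (by rintro rfl; omega)]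
        exact h4 x y hx hy hMx)
    (by
      intro π b _ b' _ h
      funext x
      have hx := congrFun h x
      by_cases hxq : x = q
      · subst hxq
        simp only [Function.update_self] at hx
        exact List.map_injective_iff.2 (Equiv.injective _) hx
      · simpa [Function.update_of_ne hxq] using hx)
    (fun _ => 1) (fun _ _ => zero_le_one) (fun _ _ _ => rfl)
    (fun b => ¬ IsPermissible K (b q) (b q')) ((blockSize D q : ℝ) / K ^ 2) (by
      intro b hb
      have := card_perm_not_permissible hT (K := K) (by omega) ((mem_arrangementsOn.1 hb).1 q) (b q')
      simp only [Function.update_self, Function.update_of_ne hqq']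
      rw [Fintype.card_perm, Fintype.card_coe, ← hcard, mul_div_assoc', div_le_iff₀ (by positivity)]
      rw [mul_comm (((block w q).card.factorial : ℕ) : ℝ)]
      exact_mod_cast this)
  simp only [Finset.sum_const, nsmul_eq_mul, mul_one] at key
  rw [div_mul_eq_mul_div, div_le_iff₀ (by positivity)] at key
  rw [mul_comm, mul_comm (K ^ 2)]
  exact_mod_cast key

/-- Dropping the permissibility constraints on pairs touching `D j` at most doubles the number of
arrangements. -/
theorem card_arrangementsOn_le (hK1 : 1 ≤ K) (hK : ∀ q, 16 * K ^ 2 ≤ blockSize D q)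
    (j : Fin (r + 2)) :
    (arrangementsOn K w fun q => ¬ Touches j q).card ≤ 2 * (arrangements K w).card := by
  classical
  set A := arrangementsOn K w fun q => ¬ Touches j q with hA
  set nxt : Fin (4 * (r + 2)) → Fin (4 * (r + 2)) := fun q =>
    if h : q.val + 1 < 4 * (r + 2) then ⟨q.val + 1, h⟩ else q with hnxt
  set S := (univ : Finset (Fin (4 * (r + 2)))).filter
    fun q => Touches j q ∧ q.val % 2 = 1 ∧ q.val + 1 < 4 * (r + 2) with hS
  have hScard : S.card ≤ 8 := by
    refine (Finset.card_le_card ?_).trans (card_touches_le j)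
    intro q hq
    simp only [hS, Finset.mem_filter, Finset.mem_univ, true_and] at hq ⊢
    exact hq.1
  have hsub : A ⊆ arrangements K w ∪
      S.biUnion fun q => A.filter fun b => ¬ IsPermissible K (b q) (b (nxt q)) := by
    intro b hb
    by_cases hb' : b ∈ arrangements K w
    · exact Finset.mem_union_left _ hb'
    refine Finset.mem_union_right _ ?_
    have hb0 := mem_arrangementsOn.1 hb
    rw [arrangements_eq, mem_arrangementsOn] at hb'
    have : ¬ ∀ q q' : Fin (4 * (r + 2)), q.val % 2 = 1 → q'.val = q.val + 1 → True →
      IsPermissible K (b q) (b q') := fun h => hb' ⟨hb0.1, hb0.2.1, hb0.2.2.1, h⟩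
    push Not at this
    obtain ⟨q, q', h1, h2, -, h3⟩ := this
    have hlt : q.val + 1 < 4 * (r + 2) := h2 ▸ q'.isLt
    have hn : nxt q = q' := by
      simp only [hnxt]
      rw [dif_pos hlt]
      exact Fin.ext h2.symm
    refine Finset.mem_biUnion.2 ⟨q, ?_, Finset.mem_filter.2 ⟨hb, by rw [hn]; exact h3⟩⟩
    refine Finset.mem_filter.2 ⟨Finset.mem_univ _, ?_, h1, hlt⟩
    by_contra hT
    exact h3 (hb0.2.2.2 q q' h1 h2 hT)
  -- Each dropped constraint fails on at most a sixteenth of `A`, and there are at most 8 of them,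
  -- so at least half of `A` satisfies all the constraints.
  have hone : ∀ q ∈ S,
      16 * (A.filter fun b => ¬ IsPermissible K (b q) (b (nxt q))).card ≤ A.card := by
    intro q hq
    obtain ⟨h1, h2, h3⟩ := (Finset.mem_filter.1 hq).2
    have hKq : K < blockSize D q := by have := hK q; nlinarith
    have hn : (nxt q).val = q.val + 1 := by
      simp only [hnxt]
      rw [dif_pos h3]
    have := card_not_permissible hD h4 hw (M := fun q => ¬ Touches j q) h2 hn (not_not.2 h1) hKq
    have h5 := Nat.mul_le_mul_left (A.filter fun b => ¬ IsPermissible K (b q) (b (nxt q))).card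
      (hK q)
    have h6 : K ^ 2 * (16 * (A.filter fun b => ¬ IsPermissible K (b q) (b (nxt q))).card) ≤
        K ^ 2 * A.card := by
      refine le_trans (le_of_eq ?_) (h5.trans this)
      ring
    exact Nat.le_of_mul_le_mul_left h6 (by positivity)
  have hsum := Finset.sum_le_sum hone
  rw [← Finset.mul_sum, Finset.sum_const, smul_eq_mul] at hsum
  have h1 := (Finset.card_le_card hsub).trans (Finset.card_union_le _ _)
  have h2 := (Finset.card_biUnion_le (s := S)
    (t := fun q => A.filter fun b => ¬ IsPermissible K (b q) (b (nxt q))))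
  have h3 := Nat.mul_le_mul_right A.card hScard
  omega

end

open Classical in
-- Given an arrangement of `w` and one of `w'`, swap their blocks touching `D j`. The two splittings
-- agree on the other blocks and no constraint straddles the division, so this is an injection of
-- pairs, and `B` follows the untouched blocks. Used in both directions, it shows that the
-- proportion of `B` is the same on both sides.
theorem card_swap_le {K : ℕ} {j : Fin (r + 2)} {w w' : Split G r}
    (hblock : ∀ q, ¬ Touches j q → block w q = block w' q)
    (hfirst : ∀ q : Fin (4 * (r + 2)), q.val = 0 → ¬ Touches j q →
      segment w.1 0 = segment w'.1 0)
    (hlast : ∀ q : Fin (4 * (r + 2)), q.val + 1 = 4 * (r + 2) → ¬ Touches j q →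
      segment w.2.1 3 = segment w'.2.1 3)
    {M M' : Fin (4 * (r + 2)) → Prop} (hM : ∀ q, ¬ Touches j q → M q)
    (hM' : ∀ q, ¬ Touches j q → M' q)
    {B : (Fin (4 * (r + 2)) → List G) → Prop}
    (hB : ∀ b b', (∀ q, ¬ Touches j q → b q = b' q) → (B b ↔ B b')) :
    ((arrangementsOn K w M).filter B).card * (arrangementsOn K w' M').card ≤
      ((arrangementsOn K w' M').filter B).card * (arrangementsOn K w M).card := by
  rw [← Finset.card_product, ← Finset.card_product]
  let mix : (Fin (4 * (r + 2)) → List G) → (Fin (4 * (r + 2)) → List G) →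
    Fin (4 * (r + 2)) → List G := fun b b' q => if Touches j q then b' q else b q
  have hmixB : ∀ b b', B (mix b b') ↔ B b := fun b b' =>
    hB _ _ fun q hq => if_neg hq
  have hmem : ∀ (w w' : Split G r) (M M' : Fin (4 * (r + 2)) → Prop),
      (∀ q, ¬ Touches j q → block w q = block w' q) →
      (∀ q : Fin (4 * (r + 2)), q.val = 0 → ¬ Touches j q → segment w.1 0 = segment w'.1 0) →
      (∀ q : Fin (4 * (r + 2)), q.val + 1 = 4 * (r + 2) → ¬ Touches j q →
        segment w.2.1 3 = segment w'.2.1 3) →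
      (∀ q, ¬ Touches j q → M q) → ∀ b ∈ arrangementsOn K w M, ∀ b' ∈ arrangementsOn K w' M',
      mix b b' ∈ arrangementsOn K w' M' := by
    intro w w' M M' h1 h2 h3 h4 b hb b' hb'
    rw [mem_arrangementsOn] at hb hb' ⊢
    refine ⟨fun q => ?_, fun q hq => ?_, fun q hq => ?_, fun q q' hq hq' hMq => ?_⟩
    · by_cases ht : Touches j q
      · simpa [mix, ht] using hb'.1 q
      · simpa [mix, ht, h1 q ht] using hb.1 q
    · by_cases ht : Touches j q
      · simpa [mix, ht] using hb'.2.1 q hq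
      · simpa [mix, ht, h2 q hq ht] using hb.2.1 q hq
    · by_cases ht : Touches j q
      · simpa [mix, ht] using hb'.2.2.1 q hq
      · simpa [mix, ht, h3 q hq ht] using hb.2.2.1 q hq
    · by_cases ht : Touches j q
      · have ht' := (touches_iff_of_pair hq hq').1 ht
        simpa [mix, ht, ht'] using hb'.2.2.2 q q' hq hq' hMq
      · have ht' : ¬ Touches j q' := fun h => ht ((touches_iff_of_pair hq hq').2 h)
        simpa [mix, ht, ht'] using hb.2.2.2 q q' hq hq' (h4 q ht)
  refine Finset.card_le_card_of_injOn (fun x => (mix x.1 x.2, mix x.2 x.1)) ?_ ?_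
  · rintro ⟨b, b'⟩ hx
    simp only [Finset.coe_product, Set.mem_prod, Finset.mem_coe, Finset.mem_filter] at hx ⊢
    obtain ⟨⟨hb, hBb⟩, hb'⟩ := hx
    refine ⟨⟨hmem w w' M M' hblock hfirst hlast hM b hb b' hb', (hmixB b b').2 hBb⟩, ?_⟩
    exact hmem w' w M' M (fun q h => (hblock q h).symm) (fun q h h' => (hfirst q h h').symm)
      (fun q h h' => (hlast q h h').symm) hM' b' hb' b hb
  · rintro ⟨b, b'⟩ _ ⟨c, c'⟩ _ h
    simp only [Prod.mk.injEq] at h ⊢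
    obtain ⟨h1, h2⟩ := h
    constructor
    · funext q
      have e1 := congrFun h1 q
      have e2 := congrFun h2 q
      by_cases ht : Touches j q
      · simpa [mix, ht] using e2
      · simpa [mix, ht] using e1
    · funext q
      have e1 := congrFun h1 q
      have e2 := congrFun h2 q
      by_cases ht : Touches j q
      · simpa [mix, ht] using e1
      · simpa [mix, ht] using e2

/-! ### Interval sums -/

theorem intervalSum_append (a b : List G) (i j : ℕ) : intervalSum (a ++ b) i j =
    intervalSum a i j + intervalSum b (i - a.length) (j - a.length) := by
  rw [intervalSum, intervalSum, intervalSum, List.take_append, List.drop_append, List.sum_append,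
    List.length_take]
  rcases le_total a.length j with h | h
  · rw [min_eq_right h]
  · rw [Nat.sub_eq_zero_of_le h]; simp

/-- Truncated subtraction does the case analysis: endpoints before a block become 0, those after it
exceed its length, and `take` and `drop` saturate. -/
theorem intervalSum_flatten {n : ℕ} (b : Fin n → List G) (i j : ℕ) :
    intervalSum (List.ofFn b).flatten i j = ∑ q, intervalSum (b q)
      (i - ∑ q' ∈ Iio q, (b q').length) (j - ∑ q' ∈ Iio q, (b q').length) := by
  induction n generalizing i j with
  | zero => simp [intervalSum]
  | succ n ih =>
    have hs : ∀ q : Fin n, ∑ q' ∈ Iio q.succ, (b q').length =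
        (b 0).length + ∑ q' ∈ Iio q, (b q'.succ).length := by
      intro q
      have key : ∀ {m : ℕ} (q : Fin m) (f : Fin m → ℕ),
          ∑ q' ∈ Iio q, f q' = ∑ q', if q' < q then f q' else 0 := by
        intro m q f
        rw [← Finset.sum_filter]
        congr 1
        ext x
        simp
      rw [key, key, Fin.sum_univ_succ]
      simp [Fin.succ_lt_succ_iff]
    have h0 : ∑ q' ∈ Iio (0 : Fin (n + 1)), (b q').length = 0 := by
      refine Finset.sum_eq_zero fun x hx => ?_
      exact absurd (Finset.mem_Iio.1 hx) (Fin.not_lt_zero x)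
    rw [List.ofFn_succ, List.flatten_cons, intervalSum_append, ih, Fin.sum_univ_succ, h0]
    simp only [hs, Nat.sub_zero, Nat.sub_sub]

/-- The number of positions of the `q`-th block in the interval `i+1, …, j`. -/
def overlap (D : Fin (r + 2) → Finset G) (m i j : ℕ) (q : Fin (4 * (r + 2))) : ℕ :=
  (Finset.Ico i j ∩ Finset.Ico (blockStart D m q) (blockStart D m q + blockSize D q)).card

theorem overlap_eq (D : Fin (r + 2) → Finset G) (m i j : ℕ) (q : Fin (4 * (r + 2))) :
    overlap D m i j q =
      min (j - blockStart D m q) (blockSize D q) - (i - blockStart D m q) := by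
  rw [overlap, Finset.Ico_inter_Ico, Nat.card_Ico]
  omega

theorem length_slice {D : Fin (r + 2) → Finset G} {m i j : ℕ} {q : Fin (4 * (r + 2))}
    {l : List G} (hl : l.length = blockSize D q) :
    ((l.take (j - blockStart D m q)).drop (i - blockStart D m q)).length = overlap D m i j q := by
  rw [List.length_drop, List.length_take, hl, overlap_eq]

theorem intervalSum_arranged {D : Fin (r + 2) → Finset G} (h4 : ∀ j, 4 ∣ (D j).card)
    {b : Fin (4 * (r + 2)) → List G} (hb : ∀ q, (b q).length = blockSize D q)
    (p n : List G) (i j : ℕ) :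
    intervalSum (arranged p n b) i j = intervalSum p.reverse i j +
      ∑ q, intervalSum (b q) (i - blockStart D p.length q) (j - blockStart D p.length q) +
      intervalSum n (i - (p.length + ∑ j, (D j).card)) (j - (p.length + ∑ j, (D j).card)) := by
  have hlen : (List.ofFn b).flatten.length = ∑ j, (D j).card := by
    rw [List.length_flatten, List.map_ofFn, List.sum_ofFn, ← sum_all_blockSize h4]
    exact Finset.sum_congr rfl fun q _ => hb q
  rw [arranged, intervalSum_append, intervalSum_append, intervalSum_flatten, List.length_append,
    List.length_reverse, hlen]
  simp only [hb, Nat.sub_sub, blockStart]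

theorem length_arranged {D : Fin (r + 2) → Finset G} (h4 : ∀ j, 4 ∣ (D j).card)
    {b : Fin (4 * (r + 2)) → List G} (hb : ∀ q, (b q).length = blockSize D q)
    (p n : List G) : (arranged p n b).length = totalLength D p n := by
  have hlen : (List.ofFn b).flatten.length = ∑ j, (D j).card := by
    rw [List.length_flatten, List.map_ofFn, List.sum_ofFn, ← sum_all_blockSize h4]
    exact Finset.sum_congr rfl fun q _ => hb q
  rw [arranged, List.length_append, List.length_append, hlen, List.length_reverse, totalLength]

theorem sum_list_eq {l : List G} (h : l.Nodup) : l.sum = ∑ x ∈ l.toFinset, x := by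
  rw [List.sum_toFinset _ h, List.map_id']

section
variable {D : Fin (r + 2) → Finset G} (h4 : ∀ j, 4 ∣ (D j).card)
  (hdisj : ∀ i j, i ≠ j → Disjoint (D i) (D j)) {w : Split G r} (hw : w ∈ splits D)
  {b : Fin (4 * (r + 2)) → List G} (hb : ∀ q, b q ∈ orderings (block w q))
include h4 hw hb

theorem length_of_mem (q : Fin (4 * (r + 2))) : (b q).length = blockSize D q := by
  rw [length_of_mem_orderings (hb q), card_block h4 hw]

theorem toFinset_subset (q : Fin (4 * (r + 2))) : (b q).toFinset ⊆ D (blockSet q) := by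
  rw [(mem_orderings.1 (hb q)).2]
  exact block_subset h4 hw q

include hdisj in
theorem map_eq_self_of_ne {j : Fin (r + 2)} (π : Equiv.Perm {x // x ∈ D j})
    {q : Fin (4 * (r + 2))} (hq : blockSet q ≠ j) :
    (b q).map (Equiv.Perm.ofSubtype π) = b q :=
  list_map_ofSubtype_of_disjoint ((hdisj _ _ hq).mono_left (toFinset_subset h4 hw hb q)) π

include hdisj in
/-- The dependence of an interval sum on the elements of `D j`. -/
theorem exists_intervalSum_map_eq (p n : List G) (i i' : ℕ) (j : Fin (r + 2)) :
    ∃ A ⊆ D j, A.card = ∑ q with blockSet q = j, overlap D p.length i i' q ∧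
      ∃ c : G, ∀ π : Equiv.Perm {x // x ∈ D j},
        intervalSum (arranged p n fun q => (b q).map (Equiv.Perm.ofSubtype π)) i i' =
          ∑ x ∈ A, Equiv.Perm.ofSubtype π x + c := by
  let sl : Fin (4 * (r + 2)) → List G := fun q =>
    ((b q).take (i' - blockStart D p.length q)).drop (i - blockStart D p.length q)
  have hlen := length_of_mem h4 hw hb
  have hslsub : ∀ q, (sl q).toFinset ⊆ block w q := by
    intro q x hx
    rw [← (mem_orderings.1 (hb q)).2]
    rw [List.mem_toFinset] at hx ⊢
    exact List.mem_of_mem_take (List.mem_of_mem_drop hx)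
  have hslnodup : ∀ q, (sl q).Nodup := fun q =>
    ((mem_orderings.1 (hb q)).1.sublist (List.take_sublist _ _)).sublist (List.drop_sublist _ _)
  have hpd : ((univ.filter fun q : Fin (4 * (r + 2)) => blockSet q = j) :
      Set (Fin (4 * (r + 2)))).PairwiseDisjoint fun q => (sl q).toFinset := by
    intro q hq q' hq' hne
    simp only [Finset.coe_filter, Finset.mem_univ, true_and, Set.mem_ofPred_eq] at hq hq'
    exact (block_disjoint h4 hw (hq.trans hq'.symm) hne).mono (hslsub q) (hslsub q')
  refine ⟨(univ.filter fun q => blockSet q = j).biUnion fun q => (sl q).toFinset, ?_, ?_,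
    intervalSum p.reverse i i' + ∑ q with ¬ blockSet q = j, (sl q).sum +
      intervalSum n (i - (p.length + ∑ j, (D j).card)) (i' - (p.length + ∑ j, (D j).card)),
    fun π => ?_⟩
  · refine Finset.biUnion_subset.2 fun q hq => ?_
    rw [← (Finset.mem_filter.1 hq).2]
    exact (hslsub q).trans (block_subset h4 hw q)
  · rw [Finset.card_biUnion hpd]
    refine Finset.sum_congr rfl fun q _ => ?_
    rw [List.toFinset_card_of_nodup (hslnodup q)]
    exact length_slice (hlen q)
  · rw [intervalSum_arranged h4 (b := fun q => (b q).map (Equiv.Perm.ofSubtype π))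
      (fun q => by rw [List.length_map, hlen q]), Finset.sum_biUnion hpd,
      ← Finset.sum_filter_add_sum_filter_not univ (fun q : Fin (4 * (r + 2)) => blockSet q = j)]
    have e1 : ∀ q, intervalSum ((b q).map (Equiv.Perm.ofSubtype π))
        (i - blockStart D p.length q) (i' - blockStart D p.length q) =
        ∑ x ∈ (sl q).toFinset, Equiv.Perm.ofSubtype π x := by
      intro q
      rw [List.sum_toFinset _ (hslnodup q), intervalSum, ← List.map_take, ← List.map_drop]
    have e2 : ∀ q ∈ univ.filter (fun q : Fin (4 * (r + 2)) => ¬ blockSet q = j),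
        intervalSum ((b q).map (Equiv.Perm.ofSubtype π))
        (i - blockStart D p.length q) (i' - blockStart D p.length q) = (sl q).sum := by
      intro q hq
      rw [map_eq_self_of_ne h4 hdisj hw hb π (Finset.mem_filter.1 hq).2]
      rfl
    rw [Finset.sum_congr rfl fun q _ => e1 q, Finset.sum_congr rfl e2]
    abel

end

/-! ### Exchanging the parts of one set between two splittings -/

/-- The splitting `w` with its data for the set `D j` replaced by that of `w'`. -/
def Split.exchange (j : Fin (r + 2)) (w w' : Split G r) : Split G r :=
  (if j = 0 then w'.1 else w.1, if j = Fin.last (r + 1) then w'.2.1 else w.2.1,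
    fun i => if j = i.castSucc.succ then w'.2.2 i else w.2.2 i)

theorem exchange_exchange (j : Fin (r + 2)) (w w' : Split G r) :
    Split.exchange j (Split.exchange j w w') (Split.exchange j w' w) = w := by
  obtain ⟨a, b, c⟩ := w
  obtain ⟨a', b', c'⟩ := w'
  simp only [Split.exchange, Prod.mk.injEq]
  refine ⟨by split_ifs <;> rfl, by split_ifs <;> rfl, funext fun i => ?_⟩
  split_ifs <;> rfl

theorem block_exchange {j : Fin (r + 2)} (w w' : Split G r) {q : Fin (4 * (r + 2))}
    (hq : blockSet q ≠ j) : block (Split.exchange j w w') q = block w q := by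
  have key : ∀ j', j' ≠ j → parts (Split.exchange j w w') j' = parts w j' := by
    intro j'
    refine fin_cases_ends
      (P := fun j' => j' ≠ j → parts (Split.exchange j w w') j' = parts w j') ?_ ?_ ?_ j'
    · intro h
      simp only [parts_zero, Split.exchange, if_neg h.symm]
    · intro h
      simp only [parts_last, Split.exchange, if_neg h.symm]
    · intro i h
      simp only [parts_middle, Split.exchange, if_neg h.symm]
  rw [block, block, key _ hq]

theorem exchange_mem_splits {D : Fin (r + 2) → Finset G} (j : Fin (r + 2)) {w w' : Split G r}
    (hw : w ∈ splits D) (hw' : w' ∈ splits D) : Split.exchange j w w' ∈ splits D := by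
  rw [mem_splits] at *
  refine ⟨?_, ?_, fun i => ?_⟩
  · simp only [Split.exchange]; split_ifs
    exacts [hw'.1, hw.1]
  · simp only [Split.exchange]; split_ifs
    exacts [hw'.2.1, hw.2.1]
  · simp only [Split.exchange]; split_ifs
    exacts [hw'.2.2 i, hw.2.2 i]

theorem mem_acceptableSplits {D : Fin (r + 2) → Finset G} {K : ℕ} {p n : List G}
    {w : Split G r} : w ∈ acceptableSplits D K p n ↔ w ∈ splits D ∧
      IsAcceptable K (delta D) p n (segment w.1 0) ∧
      IsAcceptable K (delta D) n p (segment w.2.1 3).reverse := by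
  simp only [acceptableSplits, Finset.mem_filter]

open Classical in
/-- The splittings with acceptable end orders, where an end order coming from `D j` is
unconstrained. -/
def acceptableOff (D : Fin (r + 2) → Finset G) (K : ℕ) (p n : List G) (j : Fin (r + 2)) :
    Finset (Split G r) :=
  (splits D).filter fun w =>
    (j ≠ 0 → IsAcceptable K (delta D) p n (segment w.1 0)) ∧
      (j ≠ Fin.last (r + 1) → IsAcceptable K (delta D) n p (segment w.2.1 3).reverse)

theorem mem_acceptableOff {D : Fin (r + 2) → Finset G} {K : ℕ} {p n : List G} {j : Fin (r + 2)}
    {w : Split G r} : w ∈ acceptableOff D K p n j ↔ w ∈ splits D ∧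
      (j ≠ 0 → IsAcceptable K (delta D) p n (segment w.1 0)) ∧
      (j ≠ Fin.last (r + 1) → IsAcceptable K (delta D) n p (segment w.2.1 3).reverse) := by
  simp only [acceptableOff, Finset.mem_filter]

/-- An end order coming from `D j` is taken from `w'`, where it is acceptable; any other end order
is taken from `w`, where acceptability is still required. -/
theorem exchange_mem_acceptableSplits {D : Fin (r + 2) → Finset G} {K : ℕ} {p n : List G}
    {j : Fin (r + 2)} {w w' : Split G r} (hw : w ∈ acceptableOff D K p n j)
    (hw' : w' ∈ acceptableSplits D K p n) :
    Split.exchange j w w' ∈ acceptableSplits D K p n := by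
  rw [mem_acceptableOff] at hw
  rw [mem_acceptableSplits] at *
  refine ⟨exchange_mem_splits j hw.1 hw'.1, ?_, ?_⟩
  · simp only [Split.exchange]; split_ifs with h
    exacts [hw'.2.1, hw.2.1 h]
  · simp only [Split.exchange]; split_ifs with h
    exacts [hw'.2.2, hw.2.2 h]

/-! ### Probabilities -/

open Classical in
/-- The probability of an event, multiplied by the number of acceptable splittings. -/
def mass (D : Fin (r + 2) → Finset G) (K : ℕ) (p n : List G)
    (E : (Fin (4 * (r + 2)) → List G) → Prop) : ℝ :=
  ∑ w ∈ acceptableSplits D K p n,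
    (((arrangements K w).filter E).card : ℝ) / ((arrangements K w).card : ℝ)

theorem prob_eq (D : Fin (r + 2) → Finset G) (K : ℕ) (p n : List G)
    (E : (Fin (4 * (r + 2)) → List G) → Prop) :
    prob D K p n E = mass D K p n E / ((acceptableSplits D K p n).card : ℝ) := rfl

/-- `E` depends only on the blocks that do not touch `D j`. -/
def IndependentOf (j : Fin (r + 2)) (E : (Fin (4 * (r + 2)) → List G) → Prop) : Prop :=
  ∀ b b', (∀ q, ¬ Touches j q → b q = b' q) → (E b ↔ E b')

section
variable {D : Fin (r + 2) → Finset G} (hD : ∀ j, IsDissociated (D j)) (h4 : ∀ j, 4 ∣ (D j).card)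
  (hdisj : ∀ i j, i ≠ j → Disjoint (D i) (D j))
  {K : ℕ} (hK1 : 1 ≤ K) (hK : ∀ q, 16 * K ^ 2 ≤ blockSize D q) (p n : List G)
  (j : Fin (r + 2))
include hD h4 hK1 hK

open Classical in
/-- The proportion of the arrangements, constrained away from `D j` only, in `B`. -/
def ratioOff (K : ℕ) (j : Fin (r + 2)) (B : (Fin (4 * (r + 2)) → List G) → Prop)
    (w : Split G r) : ℝ :=
  (((arrangementsOn K w fun q => ¬ Touches j q).filter B).card : ℝ) /
    ((arrangementsOn K w fun q => ¬ Touches j q).card : ℝ)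

theorem card_arrangementsOn_pos {w : Split G r} (hw : w ∈ splits D)
    (M : Fin (4 * (r + 2)) → Prop) : 0 < (arrangementsOn K w M).card := by
  have h := arrangements_nonempty hD h4 hw (K := K) (fun q => by have := hK q; nlinarith)
  rw [arrangements_eq] at h
  exact Finset.card_pos.2 (h.mono (arrangementsOn_mono fun _ _ => trivial))

theorem card_arrangements_pos {w : Split G r} (hw : w ∈ splits D) :
    0 < (arrangements K w).card := by
  rw [arrangements_eq]
  exact card_arrangementsOn_pos hD h4 hK1 hK hw _

open Classical in
-- Passage to the measure symmetric under permutations of `D j`. Numerators and the set of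
-- splittings only grow, and denominators at most double.
theorem mass_le_sum_ratioOff (E : (Fin (4 * (r + 2)) → List G) → Prop) :
    mass D K p n E ≤ 2 * ∑ w ∈ acceptableOff D K p n j, ratioOff K j E w := by
  rw [mass, Finset.mul_sum]
  have hsub : acceptableSplits D K p n ⊆ acceptableOff D K p n j := by
    intro w hw
    rw [mem_acceptableSplits] at hw
    exact mem_acceptableOff.2 ⟨hw.1, fun _ => hw.2.1, fun _ => hw.2.2⟩
  refine (Finset.sum_le_sum fun w hw => ?_).trans
    (Finset.sum_le_sum_of_subset_of_nonneg hsub fun w _ _ => by rw [ratioOff]; positivity)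
  have hws := (mem_acceptableSplits.1 hw).1
  have h1 := card_arrangements_pos hD h4 hK1 hK hws
  have h2 := card_arrangementsOn_pos hD h4 hK1 hK hws fun q => ¬ Touches j q
  have h3 := card_arrangementsOn_le hD h4 hws hK1 hK j
  have h5 : ((arrangements K w).filter E).card ≤
      ((arrangementsOn K w fun q => ¬ Touches j q).filter E).card := by
    refine Finset.card_le_card (Finset.filter_subset_filter _ ?_)
    rw [arrangements_eq]
    exact arrangementsOn_mono fun _ _ => trivial
  rw [ratioOff, mul_div_assoc', div_le_div_iff₀ (by exact_mod_cast h1) (by exact_mod_cast h2)]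
  have := Nat.mul_le_mul h5 h3
  have h6 : ((arrangements K w).filter E).card *
      (arrangementsOn K w fun q => ¬ Touches j q).card ≤
      2 * ((arrangementsOn K w fun q => ¬ Touches j q).filter E).card *
        (arrangements K w).card := by
    refine this.trans (le_of_eq (by ring))
  exact_mod_cast h6

/-- Neither the `D j`-data of the splitting nor the constraints near `D j` influence the proportion
of an event decided elsewhere. -/
theorem ratioOff_eq {B : (Fin (4 * (r + 2)) → List G) → Prop} (hB : IndependentOf j B)
    {w w' : Split G r} (hw : w ∈ splits D) (hw' : w' ∈ splits D) [DecidablePred B] :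
    ratioOff K j B w = (((arrangements K (Split.exchange j w w')).filter B).card : ℝ) /
      ((arrangements K (Split.exchange j w w')).card : ℝ) := by
  classical
  have hne : ∀ q : Fin (4 * (r + 2)), ¬ Touches j q → blockSet q ≠ j := fun q hq h =>
    hq (Or.inl h)
  have hws := exchange_mem_splits j hw hw'
  have hblock : ∀ q, ¬ Touches j q → block w q = block (Split.exchange j w w') q :=
    fun q hq => (block_exchange w w' (hne q hq)).symm
  have hfirst : ∀ q : Fin (4 * (r + 2)), q.val = 0 → ¬ Touches j q →
      segment w.1 0 = segment (Split.exchange j w w').1 0 := by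
    intro q hq ht
    have h1 : blockSet q = 0 := by
      ext; rw [blockSet_val, hq]; simp
    have := hne q ht
    rw [h1] at this
    simp only [Split.exchange, if_neg this.symm]
  have hlast : ∀ q : Fin (4 * (r + 2)), q.val + 1 = 4 * (r + 2) → ¬ Touches j q →
      segment w.2.1 3 = segment (Split.exchange j w w').2.1 3 := by
    intro q hq ht
    have h1 : blockSet q = Fin.last (r + 1) := by
      ext; rw [blockSet_val, if_neg (by omega), Fin.val_last]; omega
    have := hne q ht
    rw [h1] at this
    simp only [Split.exchange, if_neg this.symm]
  have h1 := card_arrangementsOn_pos hD h4 hK1 hK hw fun q => ¬ Touches j q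
  have h2 := card_arrangementsOn_pos hD h4 hK1 hK hws fun _ => True
  have le1 := card_swap_le (K := K) (M := fun q => ¬ Touches j q) (M' := fun _ => True)
    hblock hfirst hlast (fun q h => h) (fun _ _ => trivial) hB
  have le2 := card_swap_le (K := K) (M := fun _ => True) (M' := fun q => ¬ Touches j q)
    (fun q h => (hblock q h).symm) (fun q h h' => (hfirst q h h').symm)
    (fun q h h' => (hlast q h h').symm) (fun _ _ => trivial) (fun q h => h) hB
  rw [ratioOff, arrangements_eq, div_eq_div_iff (by exact_mod_cast h1.ne')
    (by exact_mod_cast h2.ne')]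
  have := le_antisymm le1 le2
  norm_cast
  convert this

/-- Return to the conditioned measure. Exchanging the `D j`-data injects relaxed × acceptable pairs
of splittings into acceptable × arbitrary ones and carries `ratioOff` to the true proportion. The
quotient of the numbers of acceptable and of all splittings is at least `η`. -/
theorem sum_ratioOff_le {B : (Fin (4 * (r + 2)) → List G) → Prop} (hB : IndependentOf j B) {η : ℝ}
    (hacc : η * ((splits D).card : ℝ) ≤ ((acceptableSplits D K p n).card : ℝ)) :
    η * ∑ w ∈ acceptableOff D K p n j, ratioOff K j B w ≤ mass D K p n B := by
  classical
  have hspos : (0 : ℝ) < (splits D).card := by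
    exact_mod_cast Finset.card_pos.2 (splits_nonempty h4)
  set f : Split G r → ℝ := fun w =>
    (((arrangements K w).filter B).card : ℝ) / ((arrangements K w).card : ℝ) with hf
  have hsum0 : 0 ≤ ∑ w ∈ acceptableOff D K p n j, ratioOff K j B w :=
    Finset.sum_nonneg fun w _ => by rw [ratioOff]; positivity
  have key : ((acceptableSplits D K p n).card : ℝ) *
      ∑ w ∈ acceptableOff D K p n j, ratioOff K j B w ≤
      (splits D).card * mass D K p n B := by
    calc _ = ∑ x ∈ acceptableOff D K p n j ×ˢ acceptableSplits D K p n,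
          f (Split.exchange j x.1 x.2) := by
          rw [Finset.sum_product, Finset.mul_sum]
          refine Finset.sum_congr rfl fun w hw => ?_
          rw [← nsmul_eq_mul, ← Finset.sum_const]
          refine Finset.sum_congr rfl fun w' hw' => ?_
          exact ratioOff_eq hD h4 hK1 hK j hB (mem_acceptableOff.1 hw).1
            (mem_acceptableSplits.1 hw').1
      _ = ∑ y ∈ (acceptableOff D K p n j ×ˢ acceptableSplits D K p n).image
            (fun x => (Split.exchange j x.1 x.2, Split.exchange j x.2 x.1)), f y.1 := by
          rw [Finset.sum_image]
          rintro ⟨a, b⟩ _ ⟨c, d⟩ _ h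
          simp only [Prod.mk.injEq] at h ⊢
          exact ⟨by rw [← exchange_exchange j a b, h.1, h.2, exchange_exchange],
            by rw [← exchange_exchange j b a, h.1, h.2, exchange_exchange]⟩
      _ ≤ ∑ y ∈ acceptableSplits D K p n ×ˢ splits D, f y.1 := by
          refine Finset.sum_le_sum_of_subset_of_nonneg ?_ fun y _ _ => by
            simp only [hf]; positivity
          intro y hy
          obtain ⟨⟨a, b⟩, hab, rfl⟩ := Finset.mem_image.1 hy
          rw [Finset.mem_product] at hab ⊢
          exact ⟨exchange_mem_acceptableSplits hab.1 hab.2,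
            exchange_mem_splits j (mem_acceptableSplits.1 hab.2).1 (mem_acceptableOff.1 hab.1).1⟩
      _ = _ := by
          rw [Finset.sum_product, mass, Finset.mul_sum]
          refine Finset.sum_congr rfl fun w _ => ?_
          simp only [Finset.sum_const, nsmul_eq_mul, hf]
  refine le_of_mul_le_mul_left ?_ hspos
  calc _ = (η * (splits D).card) * ∑ w ∈ acceptableOff D K p n j, ratioOff K j B w := by ring
    _ ≤ _ := (mul_le_mul_of_nonneg_right hacc hsum0).trans key

include hdisj

/-- The permutation fixes every block that is not a part of `D j`, so the retained constraints are
unaffected. -/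
theorem map_mem_arrangementsOff {w : Split G r} (hw : w ∈ splits D)
    (π : Equiv.Perm {x // x ∈ D j}) {b : Fin (4 * (r + 2)) → List G}
    (hb : b ∈ arrangementsOn K w fun q => ¬ Touches j q) :
    (fun q => (b q).map (Equiv.Perm.ofSubtype π)) ∈
      arrangementsOn K (Split.map (Equiv.Perm.ofSubtype π) w) fun q => ¬ Touches j q := by
  rw [mem_arrangementsOn] at hb ⊢
  obtain ⟨h1, h2, h3, h5⟩ := hb
  refine ⟨fun q => ?_, fun q hq => ?_, fun q hq => ?_, fun q q' hq hq' ht => ?_⟩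
  · rw [block_map]
    exact map_mem_orderings (h1 q) _
  · simp only [h2 q hq, Split.map, segment_map]
  · simp only [h3 q hq, Split.map, segment_map]
  · have ht' : ¬ Touches j q' := fun h => ht ((touches_iff_of_pair hq hq').2 h)
    rw [map_eq_self_of_ne h4 hdisj hw h1 π fun h => ht (Or.inl h),
      map_eq_self_of_ne h4 hdisj hw h1 π fun h => ht' (Or.inl h)]
    exact h5 q q' hq hq' ht

theorem map_ofSubtype_all (π : Equiv.Perm {x // x ∈ D j}) (i : Fin (r + 2)) :
    (D i).map (Equiv.Perm.ofSubtype π).toEmbedding = D i := by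
  by_cases h : i = j
  · subst h; exact map_ofSubtype_self _ π
  · exact map_ofSubtype_of_disjoint (hdisj i j h) π

theorem card_arrangementsOff_map {w : Split G r} (hw : w ∈ splits D)
    (π : Equiv.Perm {x // x ∈ D j}) :
    (arrangementsOn K (Split.map (Equiv.Perm.ofSubtype π) w) fun q => ¬ Touches j q).card =
      (arrangementsOn K w fun q => ¬ Touches j q).card := by
  have key : ∀ (π : Equiv.Perm {x // x ∈ D j}) (w : Split G r), w ∈ splits D →
      (arrangementsOn K w fun q => ¬ Touches j q).card ≤
      (arrangementsOn K (Split.map (Equiv.Perm.ofSubtype π) w) fun q => ¬ Touches j q).card := by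
    intro π w hw
    refine Finset.card_le_card_of_injOn (fun b q => (b q).map (Equiv.Perm.ofSubtype π)) ?_ ?_
    · intro b hb
      exact map_mem_arrangementsOff hD h4 hdisj hK1 hK j hw π hb
    · intro b _ b' _ h
      funext q
      exact List.map_injective_iff.2 (Equiv.injective _) (congrFun h q)
  refine le_antisymm ?_ (key π w hw)
  refine (key π⁻¹ _ (map_mem_splits (map_ofSubtype_all hD h4 hdisj hK1 hK j π) hw)).trans ?_
  rw [split_map_map, ← map_mul, inv_mul_cancel, map_one, split_map_one]

open Classical in
-- Permutations of `D j` act on pairs (splitting, arrangement) satisfying the relaxed constraints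
-- and `B`. The weight of a pair is the reciprocal of the number of relaxed arrangements, which the
-- action preserves, so that each splitting contributes its `ratioOff`.
theorem choose_mul_sum_ratioOff_le {B : (Fin (4 * (r + 2)) → List G) → Prop}
    (hB : IndependentOf j B) (i i' : ℕ) :
    ((D j).card.choose (∑ q with blockSet q = j, overlap D p.length i i' q) : ℝ) *
      ∑ w ∈ acceptableOff D K p n j,
        ratioOff K j (fun b => intervalSum (arranged p n b) i i' = 0 ∧ B b) w ≤
      ∑ w ∈ acceptableOff D K p n j, ratioOff K j B w := by
  set A : Split G r → Finset (Fin (4 * (r + 2)) → List G) :=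
    fun w => arrangementsOn K w fun q => ¬ Touches j q with hA
  have hall := map_ofSubtype_all hD h4 hdisj hK1 hK j
  have key := averaging (Γ := Equiv.Perm {x // x ∈ D j})
    ((acceptableOff D K p n j).sigma fun w => (A w).filter B)
    (fun π x => ⟨Split.map (Equiv.Perm.ofSubtype π) x.1,
      fun q => (x.2 q).map (Equiv.Perm.ofSubtype π)⟩) (by
      rintro π ⟨w, b⟩ hx
      simp only [Finset.mem_sigma, Finset.mem_filter, mem_acceptableOff] at hx ⊢
      obtain ⟨⟨hw, h1, h2⟩, hb, hBb⟩ := hx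
      have hb0 := (mem_arrangementsOn.1 hb).1
      refine ⟨⟨map_mem_splits (hall π) hw, fun hj => ?_, fun hj => ?_⟩,
        map_mem_arrangementsOff hD h4 hdisj hK1 hK j hw π hb, ?_⟩
      · simp only [Split.map]
        rw [list_map_ofSubtype_of_disjoint _ π]
        · exact h1 hj
        · rw [(mem_orderings.1 (mem_splits.1 hw).1).2]
          exact hdisj _ _ hj.symm
      · simp only [Split.map]
        rw [list_map_ofSubtype_of_disjoint _ π]
        · exact h2 hj
        · rw [(mem_orderings.1 (mem_splits.1 hw).2.1).2]
          exact hdisj _ _ hj.symm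
      · refine (hB _ _ fun q hq => ?_).1 hBb
        exact (map_eq_self_of_ne h4 hdisj hw hb0 π fun h => hq (Or.inl h)).symm)
    (by
      rintro π ⟨w, b⟩ _ ⟨w', b'⟩ _ h
      simp only [Sigma.mk.injEq, heq_eq_eq] at h ⊢
      constructor
      · have := congrArg (Split.map (Equiv.Perm.ofSubtype π)⁻¹) h.1
        rwa [split_map_map, split_map_map, inv_mul_cancel, split_map_one, split_map_one] at this
      · funext q
        exact List.map_injective_iff.2 (Equiv.injective _) (congrFun h.2 q))
    (fun x => 1 / ((A x.1).card : ℝ)) (fun _ _ => by positivity)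
    (by
      rintro π ⟨w, b⟩ hx
      simp only [Finset.mem_sigma, Finset.mem_filter, mem_acceptableOff] at hx
      simp only [hA]
      rw [card_arrangementsOff_map hD h4 hdisj hK1 hK j hx.1.1])
    (fun x => intervalSum (arranged p n x.2) i i' = 0)
    ((D j).card.choose (∑ q with blockSet q = j, overlap D p.length i i' q) : ℝ) (by
      rintro ⟨w, b⟩ hx
      simp only [Finset.mem_sigma, Finset.mem_filter, mem_acceptableOff] at hx
      obtain ⟨⟨hw, h1, h2⟩, hb, hBb⟩ := hx
      obtain ⟨S, hS, hScard, c, hc⟩ := exists_intervalSum_map_eq h4 hdisj hw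
        (mem_arrangementsOn.1 hb).1 p n i i' j
      have := (hD j).card_perm_mul_choose_le hS (-c)
      rw [hScard] at this
      simp only [hc, add_eq_zero_iff_eq_neg]
      rw [Fintype.card_perm, Fintype.card_coe]
      exact_mod_cast this)
  rw [Finset.sum_filter (s := (acceptableOff D K p n j).sigma fun w => (A w).filter B),
    Finset.sum_sigma, Finset.sum_sigma] at key
  convert key using 2
  · refine Finset.sum_congr rfl fun w _ => ?_
    simp only [← Finset.sum_filter, Finset.sum_const, nsmul_eq_mul, mul_one_div, ratioOff,
      Finset.filter_filter, hA, and_comm]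
  · simp only [Finset.sum_const, nsmul_eq_mul, mul_one_div, ratioOff, hA]

/-- The probability that an interval sum vanishes, jointly with an event that does not depend on
the blocks touching `D j`. -/
theorem choose_mul_mass_le {B : (Fin (4 * (r + 2)) → List G) → Prop} (hB : IndependentOf j B)
    {η : ℝ} (hη : 0 < η)
    (hacc : η * ((splits D).card : ℝ) ≤ ((acceptableSplits D K p n).card : ℝ)) (i i' : ℕ) :
    ((D j).card.choose (∑ q with blockSet q = j, overlap D p.length i i' q) : ℝ) * η *
      mass D K p n (fun b => intervalSum (arranged p n b) i i' = 0 ∧ B b) ≤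
      2 * mass D K p n B := by
  have h1 := mass_le_sum_ratioOff hD h4 hK1 hK p n j
    (fun b => intervalSum (arranged p n b) i i' = 0 ∧ B b)
  have h2 := choose_mul_sum_ratioOff_le hD h4 hdisj hK1 hK p n j hB i i'
  have h3 := sum_ratioOff_le hD h4 hK1 hK p n j hB hacc
  calc _ ≤ ((D j).card.choose (∑ q with blockSet q = j, overlap D p.length i i' q) : ℝ) * η *
        (2 * ∑ w ∈ acceptableOff D K p n j,
          ratioOff K j (fun b => intervalSum (arranged p n b) i i' = 0 ∧ B b) w) :=
        mul_le_mul_of_nonneg_left h1 (by positivity)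
    _ = 2 * η * (((D j).card.choose (∑ q with blockSet q = j, overlap D p.length i i' q) : ℝ) *
        ∑ w ∈ acceptableOff D K p n j,
          ratioOff K j (fun b => intervalSum (arranged p n b) i i' = 0 ∧ B b) w) := by ring
    _ ≤ 2 * η * ∑ w ∈ acceptableOff D K p n j, ratioOff K j B w :=
        mul_le_mul_of_nonneg_left h2 (by positivity)
    _ ≤ _ := by linarith

end

/-! ### Elementary facts on interval sums -/

theorem intervalSum_of_le {l : List G} {i j : ℕ} (h : j ≤ i) : intervalSum l i j = 0 := by
  rw [intervalSum, List.drop_eq_nil_of_le, List.sum_nil]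
  rw [List.length_take]; omega

theorem intervalSum_of_length_le {l : List G} {i j : ℕ} (h : l.length ≤ i) :
    intervalSum l i j = 0 := by
  rw [intervalSum, List.drop_eq_nil_of_le, List.sum_nil]
  rw [List.length_take]; omega

theorem intervalSum_to_end {l : List G} {i j : ℕ} (h : l.length ≤ j) :
    intervalSum l i j = (l.drop i).sum := by
  rw [intervalSum, List.take_of_length_le h]

theorem intervalSum_zero_left (l : List G) (j : ℕ) : intervalSum l 0 j = (l.take j).sum := rfl

theorem intervalSum_cons_succ (x : G) (l : List G) (i j : ℕ) :
    intervalSum (x :: l) (i + 1) (j + 1) = intervalSum l i j := rfl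

theorem sum_take_eq (a : List G) {i j : ℕ} (h : i ≤ j) :
    (a.take j).sum = (a.take i).sum + intervalSum a i j := by
  rw [intervalSum, ← List.sum_append]
  congr 1
  conv_lhs => rw [← List.take_append_drop i (a.take j)]
  rw [List.take_take, min_eq_left h]

theorem IsWeakSequencing.intervalSum_ne_zero {t : ℕ} {a : List G} (h : IsWeakSequencing t a)
    {i j : ℕ} (hp : IsProperInterval a.length i j) (ht : j - i ≤ t) : intervalSum a i j ≠ 0 := by
  intro h0
  have := sum_take_eq a hp.1.le
  rw [h0, add_zero] at this
  exact h i j hp ht this.symm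

theorem sum_drop_reverse (l : List G) (i : ℕ) :
    (l.reverse.drop i).sum = (l.take (l.length - i)).sum := by
  rw [List.drop_reverse, List.sum_reverse]

theorem sum_take_reverse (l : List G) (i : ℕ) :
    (l.reverse.take i).sum = (l.drop (l.length - i)).sum := by
  rw [List.take_reverse, List.sum_reverse]

theorem sum_take_mem_IS (l : List G) (i : ℕ) : (l.take i).sum ∈ IS l := by
  rcases le_total i l.length with h | h
  · exact ⟨i, h, rfl⟩
  · exact ⟨l.length, le_rfl, by rw [List.take_of_length_le h, List.take_length]⟩

theorem IsAcceptable.add_ne_zero {K : ℕ} {δ : G} {p n l : List G} (h : IsAcceptable K δ p n l)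
    {m : ℕ} (h1 : 1 ≤ m) (h2 : m ≤ K) (i : ℕ) : (p.take i).sum + (l.take m).sum ≠ 0 := by
  intro h0
  refine h m h1 h2 (Or.inl ?_)
  rw [Set.mem_neg, ← eq_neg_of_add_eq_zero_left h0]
  exact sum_take_mem_IS p i

theorem IsAcceptable.ne_add {K : ℕ} {δ : G} {p n l : List G} (h : IsAcceptable K δ p n l)
    {m : ℕ} (h1 : 1 ≤ m) (h2 : m ≤ K) (i : ℕ) : (l.take m).sum ≠ δ + (n.take i).sum := by
  intro h0
  refine h m h1 h2 (Or.inr ?_)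
  rw [h0]
  exact Set.vadd_mem_vadd_set (sum_take_mem_IS n i)

/-! ### Positions of the blocks -/

section
variable {D : Fin (r + 2) → Finset G}

theorem blockStart_zero (m : ℕ) {q : Fin (4 * (r + 2))} (h : q.val = 0) :
    blockStart D m q = m := by
  rw [blockStart, Finset.sum_eq_zero, add_zero]
  intro x hx
  have := Fin.lt_def.1 (Finset.mem_Iio.1 hx)
  omega

theorem blockStart_succ (m : ℕ) {q q' : Fin (4 * (r + 2))} (h : q'.val = q.val + 1) :
    blockStart D m q' = blockStart D m q + blockSize D q := by
  have : Iio q' = insert q (Iio q) := by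
    ext x
    simp only [Finset.mem_Iio, Finset.mem_insert, Fin.lt_def, Fin.ext_iff]
    omega
  rw [blockStart, blockStart, this, Finset.sum_insert (by simp)]
  omega

theorem blockStart_last (h4 : ∀ j, 4 ∣ (D j).card) (m : ℕ) {q : Fin (4 * (r + 2))}
    (h : q.val + 1 = 4 * (r + 2)) :
    blockStart D m q + blockSize D q = m + ∑ j, (D j).card := by
  have : (univ : Finset (Fin (4 * (r + 2)))) = insert q (Iio q) := by
    ext x
    have := x.isLt
    simp only [Finset.mem_univ, Finset.mem_Iio, Finset.mem_insert, Fin.lt_def, Fin.ext_iff,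
      true_iff]
    omega
  rw [← sum_all_blockSize h4, this, Finset.sum_insert (by simp), blockStart]
  omega

theorem le_blockStart (m : ℕ) (q : Fin (4 * (r + 2))) : m ≤ blockStart D m q :=
  Nat.le_add_right _ _

theorem blockStart_add_le (m : ℕ) {q q' : Fin (4 * (r + 2))} (h : q < q') :
    blockStart D m q + blockSize D q ≤ blockStart D m q' := by
  have : insert q (Iio q) ⊆ Iio q' := by
    intro x
    simp only [Finset.mem_Iio, Finset.mem_insert, Fin.lt_def, Fin.ext_iff] at h ⊢
    omega
  have h2 := Finset.sum_le_sum_of_subset (f := blockSize D) this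
  rw [Finset.sum_insert (by simp)] at h2
  rw [blockStart, blockStart]
  omega

theorem blockStart_add_le_last (h4 : ∀ j, 4 ∣ (D j).card) (m : ℕ) (q : Fin (4 * (r + 2))) :
    blockStart D m q + blockSize D q ≤ m + ∑ j, (D j).card := by
  set ql : Fin (4 * (r + 2)) := ⟨4 * (r + 2) - 1, by omega⟩ with hql
  have hl := blockStart_last h4 m (q := ql) (by simp only [hql]; omega)
  rcases eq_or_ne q ql with rfl | hne
  · exact hl.le
  · have hlt : q < ql := by
      rw [Fin.lt_def]
      have := q.isLt
      have h2 : q.val ≠ ql.val := fun h => hne (Fin.ext h)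
      simp only [hql] at h2 ⊢
      omega
    have := blockStart_add_le (D := D) m hlt
    omega

theorem exists_block_at (h4 : ∀ j, 4 ∣ (D j).card) (m x : ℕ) (h1 : m ≤ x)
    (h2 : x < m + ∑ j, (D j).card) :
    ∃ q, blockStart D m q ≤ x ∧ x < blockStart D m q + blockSize D q := by
  classical
  have hne : ((univ : Finset (Fin (4 * (r + 2)))).filter fun q => blockStart D m q ≤ x).Nonempty :=
    ⟨⟨0, by omega⟩, Finset.mem_filter.2 ⟨Finset.mem_univ _, by
      rw [blockStart_zero m rfl]; exact h1⟩⟩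
  obtain ⟨q, hq, hmax⟩ := Finset.exists_max_image _ id hne
  simp only [Finset.mem_filter, Finset.mem_univ, true_and, id] at hq hmax
  refine ⟨q, hq, ?_⟩
  by_cases hl : q.val + 1 = 4 * (r + 2)
  · rw [blockStart_last h4 m hl]; exact h2
  · by_contra hcon
    have hlt : q.val + 1 < 4 * (r + 2) := by have := q.isLt; omega
    have h3 := blockStart_succ (D := D) m (q := q) (q' := ⟨q.val + 1, hlt⟩) rfl
    have h5 := hmax ⟨q.val + 1, hlt⟩ (by omega)
    rw [Fin.le_def] at h5
    simp at h5

/-- Convexity: an interval meeting two blocks contains every block between them. -/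
theorem overlap_eq_blockSize {m i j : ℕ} {q₁ q q₂ : Fin (4 * (r + 2))} (h1 : q₁ < q) (h2 : q < q₂)
    (h1' : 0 < overlap D m i j q₁) (h2' : 0 < overlap D m i j q₂) :
    overlap D m i j q = blockSize D q := by
  rw [overlap_eq] at *
  have := blockStart_add_le (D := D) m h1
  have := blockStart_add_le (D := D) m h2
  omega

/-- If the four blocks of every set are alike, then all blocks are alike. -/
theorem le_overlap_of_le_overlap {K m i j : ℕ} (hK1 : 1 ≤ K) (hK : ∀ q, K ≤ blockSize D q)
    (hmix : ∀ q q' : Fin (4 * (r + 2)), blockSet q = blockSet q' →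
      K ≤ overlap D m i j q → K ≤ overlap D m i j q')
    {q₀ : Fin (4 * (r + 2))} (h : K ≤ overlap D m i j q₀) (q : Fin (4 * (r + 2))) :
    K ≤ overlap D m i j q := by
  have hconv : ∀ q₁ q q₂ : Fin (4 * (r + 2)), q₁.val ≤ q.val → q.val ≤ q₂.val →
      K ≤ overlap D m i j q₁ → K ≤ overlap D m i j q₂ → K ≤ overlap D m i j q := by
    intro q₁ q q₂ h1 h2 h3 h4
    rcases eq_or_lt_of_le h1 with h1 | h1
    · rwa [← Fin.ext h1]
    rcases eq_or_lt_of_le h2 with h2 | h2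
    · rwa [Fin.ext h2]
    rw [overlap_eq_blockSize (Fin.lt_def.2 h1) (Fin.lt_def.2 h2) (by omega) (by omega)]
    exact hK q
  have hj0 := (blockSet q₀).isLt
  have hq0 := blockSet_val q₀
  have same : ∀ q q' : Fin (4 * (r + 2)), (blockSet q).val = (blockSet q').val →
      K ≤ overlap D m i j q → K ≤ overlap D m i j q' := fun q q' hqq' => hmix q q' (Fin.ext hqq')
  -- A large overlap passes from `q₀` to blocks of the same set in both halves. By convexity it
  -- reaches the two middle blocks, parts of the last and of the first set; from these it passes to
  -- the two end blocks, and hence to all.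
  have ha := same q₀ ⟨2 * (blockSet q₀).val, by omega⟩ (by
    rw [blockSet_val (⟨2 * (blockSet q₀).val, by omega⟩ : Fin (4 * (r + 2)))]
    simp only
    rw [if_pos (by omega)]; omega) h
  have hd := same q₀ ⟨2 * (r + 2) + 2 * (blockSet q₀).val + 1, by omega⟩ (by
    rw [blockSet_val (⟨2 * (r + 2) + 2 * (blockSet q₀).val + 1, by omega⟩ : Fin (4 * (r + 2)))]
    simp only
    rw [if_neg (by omega)]; omega) h
  have hb := hconv _ ⟨2 * (r + 2) - 1, by omega⟩ _ (by simp only; omega) (by simp only; omega) ha hd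
  have hc := hconv _ ⟨2 * (r + 2), by omega⟩ _ (by simp only; omega) (by simp only; omega) ha hd
  have h0 := same _ ⟨0, by omega⟩ (by
    rw [blockSet_val, blockSet_val]
    simp only
    rw [if_neg (by omega), if_pos (by omega)]; omega) hc
  have hl := same _ ⟨4 * (r + 2) - 1, by omega⟩ (by
    rw [blockSet_val, blockSet_val]
    simp only
    rw [if_pos (by omega), if_neg (by omega)]; omega) hb
  exact hconv _ q _ (Nat.zero_le _) (by have := q.isLt; simp only; omega) h0 hl

end

/-! ### Type I intervals without a random part -/

section
variable {D : Fin (r + 2) → Finset G} (hD : ∀ j, IsDissociated (D j)) (h4 : ∀ j, 4 ∣ (D j).card)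
  (hdisj : ∀ i j, i ≠ j → Disjoint (D i) (D j))
  {K t : ℕ} (hK1 : 1 ≤ K) (hK : ∀ q, K ≤ blockSize D q) {p n : List G}
  (hW : IsWeakSequencing t (p.reverse ++ delta D :: n))
  {w : Split G r} (hw : w ∈ acceptableSplits D K p n)
  {b : Fin (4 * (r + 2)) → List G} (hb : b ∈ arrangements K w)
  {i j : ℕ} (hij : i < j) (hj : j ≤ totalLength D p n) (ht : j - i ≤ t)
include h4 hw hb

theorem intervalSum_block_eq_zero {m : ℕ} {q : Fin (4 * (r + 2))} (h : overlap D m i j q = 0) :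
    intervalSum (b q) (i - blockStart D m q) (j - blockStart D m q) = 0 := by
  rw [arrangements_eq, mem_arrangementsOn] at hb
  have hl := length_of_mem h4 (mem_acceptableSplits.1 hw).1 hb.1 q
  rw [overlap_eq] at h
  rw [intervalSum, List.drop_eq_nil_of_le, List.sum_nil]
  rw [List.length_take]; omega

include hD hK1 hK hW hij hj ht in
-- Every block has at least `K` elements, so the interval contains none and meets at most two, which
-- are adjacent. Weak sequencing handles the inside of `p` or `n`, acceptability the two outer
-- junctions, permissibility the junctions of constrained pairs, and dissociation everything within
-- a single `D s`.
theorem intervalSum_ne_zero_of_small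
    (hsmall : ∀ q, overlap D p.length i j q < K) : intervalSum (arranged p n b) i j ≠ 0 := by
  have hz := fun q => intervalSum_block_eq_zero (i := i) (j := j) (m := p.length) (q := q) h4 hw hb
  have hb' := hb
  rw [arrangements_eq, mem_arrangementsOn] at hb'
  obtain ⟨hbord, hbfirst, hblast, hbperm⟩ := hb'
  obtain ⟨hws, hacc1, hacc2⟩ := mem_acceptableSplits.1 hw
  have hlen := length_of_mem h4 hws hbord
  have hnd : ∀ q, (b q).Nodup := fun q => (mem_orderings.1 (hbord q)).1
  have hsubD := toFinset_subset h4 hws hbord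
  have hov := fun q => overlap_eq D p.length i j q
  have hend := fun q => blockStart_add_le_last (D := D) h4 p.length q
  have hstart := fun q => le_blockStart (D := D) p.length q
  rw [totalLength] at hj
  set M := ∑ j, (D j).card with hM
  have hMpos : 1 ≤ M := by
    have := hend ⟨0, by omega⟩
    have := hK ⟨0, by omega⟩
    have := hstart ⟨0, by omega⟩
    omega
  rw [intervalSum_arranged h4 hlen, ← hM]
  by_cases hA : j ≤ p.length
  · rw [Finset.sum_eq_zero fun q _ => hz q (by have := hov q; have := hstart q; omega),
      intervalSum_of_le (l := n) (by omega), add_zero, add_zero]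
    have := hW.intervalSum_ne_zero (i := i) (j := j) ⟨hij, by
      simp only [List.length_append, List.length_reverse, List.length_cons]; omega, by
      simp only [List.length_append, List.length_reverse, List.length_cons]; omega⟩ ht
    rw [intervalSum_append, List.length_reverse, intervalSum_of_le (l := _ :: _) (by omega),
      add_zero] at this
    exact this
  by_cases hB : p.length + M ≤ i
  · rw [Finset.sum_eq_zero fun q _ => hz q (by have := hov q; have := hend q; omega),
      intervalSum_of_length_le (l := p.reverse) (by rw [List.length_reverse]; omega), zero_add,
      zero_add]
    -- In the given weak sequencing the `M` block entries are replaced by the single entry `δ`, so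
    -- later positions shift by `M - 1`.
    have := hW.intervalSum_ne_zero (i := i - M + 1) (j := j - M + 1) ⟨by omega, by
      simp only [List.length_append, List.length_reverse, List.length_cons]; omega, by
      simp only [List.length_append, List.length_reverse, List.length_cons]; omega⟩ (by omega)
    rw [intervalSum_append, List.length_reverse,
      intervalSum_of_length_le (l := p.reverse) (by rw [List.length_reverse]; omega), zero_add,
      show i - M + 1 - p.length = (i - (p.length + M)) + 1 by omega,
      show j - M + 1 - p.length = (j - (p.length + M)) + 1 by omega,
      intervalSum_cons_succ] at this
    exact this
  -- The first block met by the interval.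
  obtain ⟨q, hq1, hq2⟩ := exists_block_at (D := D) h4 p.length (max i p.length) (by omega) (by omega)
  have hqov := hov q
  have hqs := hsmall q
  have hqK := hK q
  have hqe := hend q
  have hqst := hstart q
  by_cases hlast : q.val + 1 = 4 * (r + 2)
  · have hqend := blockStart_last h4 p.length hlast
    rw [← hM] at hqend
    by_cases hjM : p.length + M < j
    · -- a final segment of the last block, followed by elements of `n`
      have hi : blockStart D p.length q < i := by omega
      rw [Finset.sum_eq_single q (fun q' _ hne => hz q' (by
          have hlt : q' < q := by
            rw [Fin.lt_def]
            have := q'.isLt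
            have h2 : q'.val ≠ q.val := fun h => hne (Fin.ext h)
            omega
          have := blockStart_add_le (D := D) p.length hlt
          have := hov q'
          omega)) (by simp),
        intervalSum_of_length_le (l := p.reverse) (by rw [List.length_reverse]; omega), zero_add,
        intervalSum_to_end (by rw [hlen]; omega), show i - (p.length + M) = 0 by omega,
        intervalSum_zero_left, add_comm, hblast q hlast]
      have := hacc2.add_ne_zero (m := overlap D p.length i j q) (by omega) hqs.le
        (j - (p.length + M))
      rw [sum_take_reverse, ← hblast q hlast, hlen] at this
      rwa [← hblast q hlast, show i - blockStart D p.length q =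
        blockSize D q - overlap D p.length i j q by omega]
    · have h0 : (⟨0, by omega⟩ : Fin (4 * (r + 2))) < q := by
        rw [Fin.lt_def]; simp only; omega
      have := blockStart_add_le (D := D) p.length h0
      have := hstart ⟨0, by omega⟩
      have := hK ⟨0, by omega⟩
      have hi : blockStart D p.length q ≤ i := by omega
      rw [Finset.sum_eq_single q (fun q' _ hne => hz q' (by
          have hlt : q' < q := by
            rw [Fin.lt_def]
            have := q'.isLt
            have h2 : q'.val ≠ q.val := fun h => hne (Fin.ext h)
            omega
          have := blockStart_add_le (D := D) p.length hlt
          have := hov q'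
          omega)) (by simp),
        intervalSum_of_length_le (l := p.reverse) (by rw [List.length_reverse]; omega), zero_add,
        intervalSum_of_le (l := n) (by omega), add_zero, intervalSum, sum_list_eq
        (((hnd q).sublist (List.take_sublist _ _)).sublist (List.drop_sublist _ _))]
      refine (hD (blockSet q)).sum_ne_zero ?_ ?_
      · refine Finset.Subset.trans (fun x hx => ?_) (hsubD q)
        rw [List.mem_toFinset] at hx ⊢
        exact List.mem_of_mem_take (List.mem_of_mem_drop hx)
      · rw [← Finset.card_pos, List.toFinset_card_of_nodup
          (((hnd q).sublist (List.take_sublist _ _)).sublist (List.drop_sublist _ _)),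
          length_slice (hlen q)]
        omega
  have hlt1 : q.val + 1 < 4 * (r + 2) := by have := q.isLt; omega
  set q' : Fin (4 * (r + 2)) := ⟨q.val + 1, hlt1⟩ with hq'
  have hsucc : q'.val = q.val + 1 := rfl
  have hst' := blockStart_succ (D := D) p.length hsucc
  have hq'ov := hov q'
  have hq's := hsmall q'
  have hq'K := hK q'
  have hq'e := hend q'
  have hbefore : blockStart D p.length q ≤ i ∨ q.val = 0 := by
    by_contra! hcon
    have h0 : (⟨0, by omega⟩ : Fin (4 * (r + 2))) < q := by
      rw [Fin.lt_def]; simp only; omega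
    have := blockStart_add_le (D := D) p.length h0
    have := hstart ⟨0, by omega⟩
    have := hK ⟨0, by omega⟩
    omega
  have hz1 : ∀ x : Fin (4 * (r + 2)), x < q → overlap D p.length i j x = 0 := by
    intro x hx
    rcases hbefore with h | h
    · have := blockStart_add_le (D := D) p.length hx
      have := hov x
      omega
    · rw [Fin.lt_def] at hx; omega
  have hz2 : ∀ x : Fin (4 * (r + 2)), q' < x → overlap D p.length i j x = 0 := by
    intro x hx
    have := blockStart_add_le (D := D) p.length hx
    have := hov x
    omega
  have hnpart : intervalSum n (i - (p.length + M)) (j - (p.length + M)) = 0 :=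
    intervalSum_of_le (by omega)
  have hne : q ≠ q' := fun h => by have := congrArg Fin.val h; omega
  have hsum2 : ∑ x, intervalSum (b x) (i - blockStart D p.length x) (j - blockStart D p.length x) =
      intervalSum (b q) (i - blockStart D p.length q) (j - blockStart D p.length q) +
      intervalSum (b q') (i - blockStart D p.length q') (j - blockStart D p.length q') := by
    rw [← Finset.sum_pair (f := fun x => intervalSum (b x) (i - blockStart D p.length x)
      (j - blockStart D p.length x)) hne]
    refine (Finset.sum_subset (Finset.subset_univ _) fun x _ hx => hz x ?_).symm
    simp only [Finset.mem_insert, Finset.mem_singleton, not_or] at hx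
    have h2 : x.val ≠ q.val := fun h => hx.1 (Fin.ext h)
    have h3 : x.val ≠ q'.val := fun h => hx.2 (Fin.ext h)
    rcases lt_or_ge x q with h | h
    · exact hz1 x h
    · refine hz2 x ?_
      rw [Fin.le_def] at h
      rw [Fin.lt_def]
      omega
  rw [hnpart, add_zero, hsum2]
  by_cases hjq : j ≤ blockStart D p.length q + blockSize D q
  · rw [hz q' (by omega), add_zero]
    by_cases hi : i < p.length
    · -- elements of `p`, followed by an initial segment of the first block
      have hq0 : q.val = 0 := by
        rcases hbefore with h | h
        · omega
        · exact h
      rw [blockStart_zero p.length hq0, intervalSum_to_end (by rw [List.length_reverse]; omega),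
        sum_drop_reverse, show i - p.length = 0 by omega, intervalSum_zero_left, hbfirst q hq0]
      have h0 := blockStart_zero (D := D) p.length hq0
      exact hacc1.add_ne_zero (by omega) (by omega) _
    · rw [intervalSum_of_length_le (l := p.reverse) (by rw [List.length_reverse]; omega), zero_add,
        intervalSum, sum_list_eq
        (((hnd q).sublist (List.take_sublist _ _)).sublist (List.drop_sublist _ _))]
      refine (hD (blockSet q)).sum_ne_zero ?_ ?_
      · refine Finset.Subset.trans (fun x hx => ?_) (hsubD q)
        rw [List.mem_toFinset] at hx ⊢
        exact List.mem_of_mem_take (List.mem_of_mem_drop hx)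
      · rw [← Finset.card_pos, List.toFinset_card_of_nodup
          (((hnd q).sublist (List.take_sublist _ _)).sublist (List.drop_sublist _ _)),
          length_slice (hlen q)]
        omega
  · -- a final segment of a block, followed by an initial segment of the next
    have hi : blockStart D p.length q < i := by omega
    rw [intervalSum_of_length_le (l := p.reverse) (by rw [List.length_reverse]; omega), zero_add,
      intervalSum_to_end (by rw [hlen]; omega), show i - blockStart D p.length q' = 0 by omega,
      intervalSum_zero_left]
    have hiov : i - blockStart D p.length q = blockSize D q - overlap D p.length i j q := by omega
    -- For odd `q` the junction is a constrained pair; for even `q` both blocks are parts of the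
    -- same dissociated set.
    by_cases hodd : q.val % 2 = 1
    · have := hbperm q q' hodd hsucc trivial (overlap D p.length i j q)
        (j - blockStart D p.length q') (by omega) hqs.le (by omega) (by omega)
      rwa [sum_take_reverse, hlen, ← hiov] at this
    · have hset : blockSet q' = blockSet q := by
        ext
        rw [blockSet_val, blockSet_val, hsucc]
        split_ifs <;> omega
      have hn1 : ((b q).drop (i - blockStart D p.length q)).Nodup :=
        (hnd q).sublist (List.drop_sublist _ _)
      have hn2 : ((b q').take (j - blockStart D p.length q')).Nodup :=
        (hnd q').sublist (List.take_sublist _ _)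
      have hs1 : ((b q).drop (i - blockStart D p.length q)).toFinset ⊆ (b q).toFinset := by
        intro x hx
        rw [List.mem_toFinset] at hx ⊢
        exact List.mem_of_mem_drop hx
      have hs2 : ((b q').take (j - blockStart D p.length q')).toFinset ⊆ (b q').toFinset := by
        intro x hx
        rw [List.mem_toFinset] at hx ⊢
        exact List.mem_of_mem_take hx
      have hdis : Disjoint (b q).toFinset (b q').toFinset := by
        rw [(mem_orderings.1 (hbord q)).2, (mem_orderings.1 (hbord q')).2]
        exact block_disjoint h4 hws hset.symm hne
      rw [sum_list_eq hn1, sum_list_eq hn2, ← Finset.sum_union (hdis.mono hs1 hs2)]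
      refine (hD (blockSet q)).sum_ne_zero (Finset.union_subset (hs1.trans (hsubD q))
        (hs2.trans (hset ▸ hsubD q'))) (Finset.Nonempty.inl ?_)
      rw [← Finset.card_pos, List.toFinset_card_of_nodup hn1, List.length_drop, hlen]
      omega

theorem sum_arrangement : ∑ q, (b q).sum = delta D := by
  rw [arrangements_eq, mem_arrangementsOn] at hb
  have hws := (mem_acceptableSplits.1 hw).1
  rw [delta, ← Finset.sum_fiberwise univ (fun q : Fin (4 * (r + 2)) => blockSet q)]
  refine Finset.sum_congr rfl fun j _ => ?_
  rw [← sum_blocks h4 hws j]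
  refine Finset.sum_congr rfl fun q _ => ?_
  rw [sum_list_eq (mem_orderings.1 (hb.1 q)).1, (mem_orderings.1 (hb.1 q)).2]

include hdisj hK1 hK hW hij hj ht in
-- The interval misses only `h < K` initial entries of the first block and `h' < K` final entries of
-- the last one. Its sum is therefore `δ` minus the sums of the missed entries, plus what it takes
-- from `p` and `n`.
theorem intervalSum_ne_zero_of_large (hU : IsDissociated (D 0 ∪ D (Fin.last (r + 1)) ∪ {delta D}))
    (hprop : j - i < totalLength D p n)
    (hlarge : ∀ q, K ≤ overlap D p.length i j q ∧ blockSize D q < overlap D p.length i j q + K) :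
    intervalSum (arranged p n b) i j ≠ 0 := by
  have hδ := sum_arrangement h4 hw hb
  have hb' := hb
  rw [arrangements_eq, mem_arrangementsOn] at hb'
  obtain ⟨hbord, hbfirst, hblast, hbperm⟩ := hb'
  obtain ⟨hws, hacc1, hacc2⟩ := mem_acceptableSplits.1 hw
  have hlen := length_of_mem h4 hws hbord
  have hnd : ∀ q, (b q).Nodup := fun q => (mem_orderings.1 (hbord q)).1
  have hsubD := toFinset_subset h4 hws hbord
  have hov := fun q => overlap_eq D p.length i j q
  rw [totalLength] at hj hprop
  set M := ∑ j, (D j).card with hM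
  set f : Fin (4 * (r + 2)) := ⟨0, by omega⟩ with hf
  set l : Fin (4 * (r + 2)) := ⟨4 * (r + 2) - 1, by omega⟩ with hl
  have hfl : f < l := by rw [Fin.lt_def]; simp only [hf, hl]; omega
  have hlval : l.val + 1 = 4 * (r + 2) := by simp only [hl]; omega
  have hstf := blockStart_zero (D := D) p.length (q := f) rfl
  have hstl := blockStart_last h4 p.length hlval
  rw [← hM] at hstl
  have hfl' := blockStart_add_le (D := D) p.length hfl
  have hlf := hlarge f
  have hll := hlarge l
  have hovf := hov f
  have hovl := hov l
  have hKf := hK f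
  have hKl := hK l
  set h := i - p.length with hh
  set h' := p.length + M - j with hh'
  have hhK : h < K := by omega
  have hhK' : h' < K := by omega
  have hblocks : ∑ q, intervalSum (b q) (i - blockStart D p.length q) (j - blockStart D p.length q) =
      delta D - ((b f).take h).sum - ((b l).reverse.take h').sum := by
    have : ∀ q, intervalSum (b q) (i - blockStart D p.length q) (j - blockStart D p.length q) =
        (b q).sum - (if q = f then ((b f).take h).sum else 0) -
          (if q = l then ((b l).reverse.take h').sum else 0) := by
      intro q
      by_cases hqf : q = f
      · subst hqf
        rw [if_pos rfl, if_neg hfl.ne, sub_zero, hstf, intervalSum_to_end (by rw [hlen]; omega),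
          ← hh, eq_sub_iff_add_eq, add_comm, ← List.sum_append, List.take_append_drop]
      by_cases hql : q = l
      · subst hql
        rw [if_neg hqf, if_pos rfl, sub_zero, show i - blockStart D p.length l = 0 by omega,
          intervalSum_zero_left, sum_take_reverse, eq_sub_iff_add_eq, hlen,
          show (b l).take (j - blockStart D p.length l) = (b l).take (blockSize D l - h') from
            List.take_eq_take_iff.2 (by rw [hlen]; omega),
          ← List.sum_append, List.take_append_drop]
      · rw [if_neg hqf, if_neg hql, sub_zero, sub_zero]
        have h1 : f < q := by
          rw [Fin.lt_def]
          have : q.val ≠ f.val := fun h => hqf (Fin.ext h)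
          simp only [hf] at this ⊢; omega
        have h2 : q < l := by
          rw [Fin.lt_def]
          have := q.isLt
          have : q.val ≠ l.val := fun h => hql (Fin.ext h)
          omega
        have := blockStart_add_le (D := D) p.length h1
        have := blockStart_add_le (D := D) p.length h2
        rw [show i - blockStart D p.length q = 0 by omega, intervalSum_zero_left,
          List.take_of_length_le (by rw [hlen]; omega)]
    rw [Finset.sum_congr rfl fun q _ => this q, Finset.sum_sub_distrib, Finset.sum_sub_distrib, hδ,
      Finset.sum_ite_eq' univ f, Finset.sum_ite_eq' univ l, if_pos (Finset.mem_univ _),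
      if_pos (Finset.mem_univ _)]
  rw [intervalSum_arranged h4 hlen, ← hM, hblocks, intervalSum_to_end
    (by rw [List.length_reverse]; omega), sum_drop_reverse, show i - (p.length + M) = 0 by omega,
    intervalSum_zero_left]
  intro h0
  -- If nothing is missed, contract the blocks to `δ` and use weak sequencing. If entries are missed
  -- at one end only, acceptability at that end applies. If at both, nothing comes from `p` or `n`,
  -- and `{δ}` would have the same sum as a set of `h + h' ≥ 2` elements in a dissociated set.
  rcases Nat.eq_zero_or_pos h with e | e <;> rcases Nat.eq_zero_or_pos h' with e' | e'
  · have := hW.intervalSum_ne_zero (i := i) (j := j - M + 1) ⟨by omega, by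
      simp only [List.length_append, List.length_reverse, List.length_cons]; omega, by
      simp only [List.length_append, List.length_reverse, List.length_cons]; omega⟩ (by omega)
    rw [intervalSum_append, List.length_reverse, intervalSum_to_end
      (by rw [List.length_reverse]; omega), sum_drop_reverse, ← hh, e, intervalSum_zero_left,
      show j - M + 1 - p.length = (j - (p.length + M)) + 1 by omega, List.take_succ_cons,
      List.sum_cons] at this
    apply this
    rw [e, e', List.take_zero, List.take_zero, List.sum_nil, sub_zero, sub_zero] at h0
    rw [← h0, add_assoc]
  · have := hacc2.ne_add (m := h') e' hhK'.le (p.length - i)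
    apply this
    rw [← hblast l hlval]
    rw [e, show j - (p.length + M) = 0 by omega, List.take_zero, List.take_zero, List.sum_nil,
      sub_zero, add_zero] at h0
    rw [eq_comm, ← sub_eq_zero, ← h0]
    abel
  · have := hacc1.ne_add (m := h) e hhK.le (j - (p.length + M))
    apply this
    rw [← hbfirst f rfl]
    rw [e', show p.length - i = 0 by omega, List.take_zero, List.take_zero, List.sum_nil,
      sub_zero, zero_add] at h0
    rw [eq_comm, ← sub_eq_zero, ← h0]
    abel
  · rw [show j - (p.length + M) = 0 by omega, show p.length - i = 0 by omega, List.take_zero,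
      List.take_zero, List.sum_nil, zero_add, add_zero] at h0
    have hn1 : ((b f).take h).Nodup := (hnd f).sublist (List.take_sublist _ _)
    have hn2 : ((b l).reverse.take h').Nodup :=
      (List.nodup_reverse.2 (hnd l)).sublist (List.take_sublist _ _)
    have hsf : blockSet f = 0 := by
      ext; rw [blockSet_val]; simp [hf]
    have hsl : blockSet l = Fin.last (r + 1) := by
      ext; rw [blockSet_val, if_neg (by omega), Fin.val_last]; omega
    have hs1 : ((b f).take h).toFinset ⊆ D 0 := by
      intro x hx
      rw [List.mem_toFinset] at hx
      rw [← hsf]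
      exact hsubD f (List.mem_toFinset.2 (List.mem_of_mem_take hx))
    have hs2 : ((b l).reverse.take h').toFinset ⊆ D (Fin.last (r + 1)) := by
      intro x hx
      rw [List.mem_toFinset] at hx
      rw [← hsl]
      exact hsubD l (List.mem_toFinset.2 (List.mem_reverse.1 (List.mem_of_mem_take hx)))
    have hdis := (hdisj 0 (Fin.last (r + 1)) (Fin.last_pos.ne)).mono hs1 hs2
    have hc1 : ((b f).take h).toFinset.card = h := by
      rw [List.toFinset_card_of_nodup hn1, List.length_take, hlen]; omega
    have hc2 : ((b l).reverse.take h').toFinset.card = h' := by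
      rw [List.toFinset_card_of_nodup hn2, List.length_take, List.length_reverse, hlen]; omega
    have key := hU.eq_of_sum_sub_eq (S := {delta D})
      (T := ((b f).take h).toFinset ∪ ((b l).reverse.take h').toFinset)
      Finset.subset_union_right
      ((Finset.union_subset_union hs1 hs2).trans Finset.subset_union_left) (by
        rw [Finset.sum_singleton, Finset.sum_union hdis, ← sum_list_eq hn1, ← sum_list_eq hn2]
        rw [← sub_eq_zero, ← h0]
        abel)
    have := congrArg Finset.card key
    rw [Finset.card_singleton, Finset.card_union_of_disjoint hdis, hc1, hc2] at this
    omega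

include hD hdisj hK1 hK hW hij hj ht in
/-- An interval that is not of Type II and treats the four blocks of every `D j` alike never has
sum zero. -/
theorem intervalSum_ne_zero (hU : IsDissociated (D 0 ∪ D (Fin.last (r + 1)) ∪ {delta D}))
    (hprop : j - i < totalLength D p n) (hII : ¬ IsTypeII D p.length K i j)
    (hmix : ∀ q q' : Fin (4 * (r + 2)), blockSet q = blockSet q' →
      K ≤ overlap D p.length i j q → K ≤ overlap D p.length i j q') :
    intervalSum (arranged p n b) i j ≠ 0 := by
  by_cases hH : ∃ q, K ≤ overlap D p.length i j q
  · obtain ⟨q₀, hq₀⟩ := hH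
    have hall := le_overlap_of_le_overlap hK1 hK hmix hq₀
    refine intervalSum_ne_zero_of_large h4 hdisj hK1 hK hW hw hb hij hj ht hU hprop fun q =>
      ⟨hall q, ?_⟩
    by_contra hcon
    exact hII ⟨q, hall q, not_lt.1 hcon⟩
  · push Not at hH
    exact intervalSum_ne_zero_of_small hD h4 hK1 hK hW hw hb hij hj ht hH

end

/-! ### Properties of `mass` -/

section
variable {D : Fin (r + 2) → Finset G} {K : ℕ} {p n : List G}

theorem mass_nonneg (E : (Fin (4 * (r + 2)) → List G) → Prop) : 0 ≤ mass D K p n E :=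
  Finset.sum_nonneg fun _ _ => by positivity

theorem mass_mono {E F : (Fin (4 * (r + 2)) → List G) → Prop}
    (h : ∀ w ∈ acceptableSplits D K p n, ∀ b ∈ arrangements K w, E b → F b) :
    mass D K p n E ≤ mass D K p n F := by
  classical
  refine Finset.sum_le_sum fun w hw => div_le_div_of_nonneg_right ?_ (by positivity)
  have : (arrangements K w).filter E ⊆ (arrangements K w).filter F := by
    intro b hb
    rw [Finset.mem_filter] at hb ⊢
    exact ⟨hb.1, h w hw b hb.1 hb.2⟩
  exact_mod_cast Finset.card_le_card this

theorem mass_add (A B : Set (Fin (4 * (r + 2)) → List G)) :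
    mass D K p n (· ∈ A) = mass D K p n (· ∈ A ∩ B) + mass D K p n (· ∈ A \ B) := by
  classical
  simp only [mass]
  rw [← Finset.sum_add_distrib]
  refine Finset.sum_congr rfl fun w _ => ?_
  have h := Finset.card_filter_add_card_filter_not (s := (arrangements K w).filter (· ∈ A)) (· ∈ B)
  rw [Finset.filter_filter, Finset.filter_filter] at h
  rw [← add_div, ← Nat.cast_add]
  refine congrArg₂ (· / ·) (congrArg Nat.cast ?_) rfl
  convert h.symm
  · exact Set.mem_inter_iff _ _ _
  · exact Set.mem_sdiff _

end

/-! ### Overlaps with one of the sets -/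

section
variable {D : Fin (r + 2) → Finset G} (h4 : ∀ j, 4 ∣ (D j).card)

theorem overlap_le_blockSize (m i j : ℕ) (q : Fin (4 * (r + 2))) :
    overlap D m i j q ≤ blockSize D q := by
  rw [overlap_eq]; omega

theorem overlap_le_sum (m i j : ℕ) {q : Fin (4 * (r + 2))} {s : Fin (r + 2)}
    (hq : blockSet q = s) : overlap D m i j q ≤ ∑ q with blockSet q = s, overlap D m i j q :=
  Finset.single_le_sum (f := overlap D m i j) (fun _ _ => Nat.zero_le _)
    (Finset.mem_filter.2 ⟨Finset.mem_univ _, hq⟩)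

include h4 in
theorem sum_overlap_add_le (m i j : ℕ) {q : Fin (4 * (r + 2))} {s : Fin (r + 2)}
    (hq : blockSet q = s) : (∑ q with blockSet q = s, overlap D m i j q) +
      (blockSize D q - overlap D m i j q) ≤ (D s).card := by
  have h1 := Finset.single_le_sum (f := fun q => blockSize D q - overlap D m i j q)
    (s := univ.filter fun q => blockSet q = s)
    (fun _ _ => Nat.zero_le _) (Finset.mem_filter.2 ⟨Finset.mem_univ q, hq⟩)
  have h2 : ∑ q with blockSet q = s, (overlap D m i j q + (blockSize D q - overlap D m i j q)) =
      (D s).card := by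
    rw [← sum_blockSize h4 s]
    refine Finset.sum_congr rfl fun q _ => ?_
    have := overlap_le_blockSize (D := D) m i j q
    omega
  rw [Finset.sum_add_distrib] at h2
  omega

include h4 in
/-- For an interval that is not of Type II and does not treat the four blocks of every set alike,
the number of its positions in one of the sets is far from extreme. -/
theorem exists_mixed {K m i j : ℕ} (hK : ∀ q, 2 * K ≤ blockSize D q)
    (hII : ¬ IsTypeII D m K i j)
    (hmix : ¬ ∀ q q' : Fin (4 * (r + 2)), blockSet q = blockSet q' →
      K ≤ overlap D m i j q → K ≤ overlap D m i j q') :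
    ∃ s, (D s).card / 4 / 2 ≤ ∑ q with blockSet q = s, overlap D m i j q ∧
      (∑ q with blockSet q = s, overlap D m i j q) + (D s).card / 4 / 2 ≤ (D s).card := by
  push Not at hmix
  obtain ⟨q, q', h1, h2, h3⟩ := hmix
  -- Since `2K` is at most the block size, at least half of `q` is inside the interval and at least
  -- half of `q'`, a block of the same set, is outside.
  have h5 : blockSize D q < overlap D m i j q + K := by
    by_contra hcon
    exact hII ⟨q, h2, not_lt.1 hcon⟩
  have h6 := hK q
  have h7 : blockSize D q' = blockSize D q := by rw [blockSize, blockSize, h1]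
  have h8 := overlap_le_sum (D := D) m i j (q := q) rfl
  have h9 := sum_overlap_add_le h4 m i j h1.symm
  have h10 : blockSize D q = (D (blockSet q)).card / 4 := rfl
  refine ⟨blockSet q, ?_, ?_⟩ <;> omega

end

/-! ### The vanishing of an interval sum as an event on the blocks it meets -/

/-- The sum over the interval `i+1, …, j` vanishes, written in terms of the blocks it meets. -/
def Vanishes (D : Fin (r + 2) → Finset G) (p n : List G) (i j : ℕ)
    (b : Fin (4 * (r + 2)) → List G) : Prop :=
  intervalSum p.reverse i j +
    ∑ q with 0 < overlap D p.length i j q,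
      intervalSum (b q) (i - blockStart D p.length q) (j - blockStart D p.length q) +
    intervalSum n (i - (p.length + ∑ j, (D j).card)) (j - (p.length + ∑ j, (D j).card)) = 0

/-- In `arranged` the place of a block depends on the lengths of all earlier ones. `Vanishes` uses
the deterministic positions instead, so it has the locality that the local lemma needs. -/
theorem vanishes_congr {D : Fin (r + 2) → Finset G} {p n : List G} {i j : ℕ}
    {b b' : Fin (4 * (r + 2)) → List G}
    (h : ∀ q, 0 < overlap D p.length i j q → b q = b' q) :
    Vanishes D p n i j b ↔ Vanishes D p n i j b' := by
  rw [Vanishes, Vanishes, Finset.sum_congr rfl fun q hq => ?_]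
  rw [h q (Finset.mem_filter.1 hq).2]

theorem vanishes_iff {D : Fin (r + 2) → Finset G} (h4 : ∀ j, 4 ∣ (D j).card) {K : ℕ}
    {p n : List G} {w : Split G r} (hw : w ∈ acceptableSplits D K p n)
    {b : Fin (4 * (r + 2)) → List G} (hb : b ∈ arrangements K w) (i j : ℕ) :
    Vanishes D p n i j b ↔ intervalSum (arranged p n b) i j = 0 := by
  have hb' := hb
  rw [arrangements_eq, mem_arrangementsOn] at hb'
  have hlen := length_of_mem h4 (mem_acceptableSplits.1 hw).1 hb'.1
  rw [Vanishes, intervalSum_arranged h4 hlen, Finset.sum_filter_of_ne]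
  intro q _ hq
  by_contra hcon
  exact hq (intervalSum_block_eq_zero h4 hw hb (by omega))

/-- The number of short intervals that meet a given block. -/
theorem card_meeting_le (D : Fin (r + 2) → Finset G) (m t : ℕ) (q : Fin (4 * (r + 2)))
    (J : Finset (ℕ × ℕ)) (hJ : ∀ x ∈ J, x.1 < x.2 ∧ x.2 - x.1 ≤ t)
    (hq : ∀ x ∈ J, 0 < overlap D m x.1 x.2 q) : J.card ≤ (t + blockSize D q) * t := by
  have : J.card ≤ (Finset.range (t + blockSize D q) ×ˢ Finset.range t).card := by
    -- An interval meeting the block starts less than `t` before it or inside it; adding `t` keeps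
    -- the relative start out of truncation.
    refine Finset.card_le_card_of_injOn
      (fun x => (x.1 + t - blockStart D m q, x.2 - x.1 - 1)) ?_ ?_
    · rintro ⟨i, j⟩ hx
      have h1 := hJ _ hx
      have h2 := hq _ hx
      rw [overlap_eq] at h2
      simp only [Finset.coe_product, Set.mem_prod, Finset.mem_coe, Finset.mem_range] at h1 h2 ⊢
      omega
    · rintro ⟨i, j⟩ hx ⟨i', j'⟩ hx' h
      have h1 := hJ _ hx
      have h2 := hq _ hx
      have h1' := hJ _ hx'
      have h2' := hq _ hx'
      rw [overlap_eq] at h2 h2'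
      simp only [Prod.mk.injEq] at h1 h2 h1' h2' h ⊢
      omega
  rwa [Finset.card_product, Finset.card_range, Finset.card_range] at this

section
variable {D : Fin (r + 2) → Finset G} (hD : ∀ j, IsDissociated (D j)) (h4 : ∀ j, 4 ∣ (D j).card)
  (hdisj : ∀ i j, i ≠ j → Disjoint (D i) (D j))
  {K : ℕ} (hK1 : 1 ≤ K) (hK : ∀ q, 16 * K ^ 2 ≤ blockSize D q) {p n : List G}
  {η : ℝ} (hη : 0 < η)
  (hacc : η * ((splits D).card : ℝ) ≤ ((acceptableSplits D K p n).card : ℝ))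
include hD h4 hK1 hK

theorem mass_univ {E : (Fin (4 * (r + 2)) → List G) → Prop} (hE : ∀ b, E b) :
    mass D K p n E = ((acceptableSplits D K p n).card : ℝ) := by
  classical
  rw [mass, Finset.card_eq_sum_ones, Nat.cast_sum]
  refine Finset.sum_congr rfl fun w hw => ?_
  have := card_arrangements_pos hD h4 hK1 hK (mem_acceptableSplits.1 hw).1
  rw [Finset.filter_true_of_mem fun b _ => hE b, Nat.cast_one, div_self]
  exact_mod_cast this.ne'

include hη hacc in
theorem card_acceptableSplits_pos : 0 < (acceptableSplits D K p n).card := by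
  have h1 : (0 : ℝ) < (splits D).card := by
    exact_mod_cast Finset.card_pos.2 (splits_nonempty h4)
  have h2 : (0 : ℝ) < (acceptableSplits D K p n).card := (mul_pos hη h1).trans_le hacc
  exact_mod_cast h2

include hdisj hη hacc

/-- The conditional estimate in the form required by the lopsided local lemma. -/
theorem mass_vanishes_le {s : Fin (r + 2)} {B : (Fin (4 * (r + 2)) → List G) → Prop}
    (hB : IndependentOf s B) {i j a : ℕ}
    (h1 : a ≤ ∑ q with blockSet q = s, overlap D p.length i j q)
    (h2 : (∑ q with blockSet q = s, overlap D p.length i j q) + a ≤ (D s).card) :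
    mass D K p n (fun b => intervalSum (arranged p n b) i j = 0 ∧ B b) ≤
      2 / (η * (D s).card.choose a) * mass D K p n B := by
  have key := choose_mul_mass_le hD h4 hdisj hK1 hK p n s hB hη hacc i j
  have hc : ((D s).card.choose a : ℝ) ≤
      ((D s).card.choose (∑ q with blockSet q = s, overlap D p.length i j q) : ℝ) := by
    exact_mod_cast choose_le_choose_of_between h1 h2
  have hpos : (0 : ℝ) < (D s).card.choose a := by
    exact_mod_cast Nat.choose_pos (by omega)
  rw [div_mul_eq_mul_div, le_div_iff₀ (by positivity)]
  refine le_trans ?_ key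
  rw [mul_comm, mul_comm η]
  exact mul_le_mul_of_nonneg_right (mul_le_mul_of_nonneg_right hc hη.le) (mass_nonneg _)

theorem prob_intervalSum_le {s : Fin (r + 2)} {i j a : ℕ}
    (h1 : a ≤ ∑ q with blockSet q = s, overlap D p.length i j q)
    (h2 : (∑ q with blockSet q = s, overlap D p.length i j q) + a ≤ (D s).card) :
    prob D K p n (fun b => intervalSum (arranged p n b) i j = 0) ≤
      2 / (η * (D s).card.choose a) := by
  have key := mass_vanishes_le hD h4 hdisj hK1 hK hη hacc (B := fun _ => True)
    (fun _ _ _ => Iff.rfl) h1 h2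
  rw [mass_univ hD h4 hK1 hK (E := fun _ => True) fun _ => trivial] at key
  have hpos : (0 : ℝ) < (acceptableSplits D K p n).card := by
    exact_mod_cast card_acceptableSplits_pos hD h4 hK1 hK hη hacc
  rw [prob_eq, div_le_iff₀ hpos]
  simpa using key

/-- With positive mass, no short interval with a non-extreme number of positions in one of the sets
has sum zero. -/
theorem mass_avoid_pos {t S : ℕ} (hS : ∀ q, blockSize D q ≤ S) {ρ : ℝ}
    (hρ : ∀ s, 2 / (η * (D s).card.choose K) ≤ ρ)
    (hsmall : 4 * ρ * (8 * ((t + S) * t) + 1 : ℕ) ≤ 1) (N : ℕ) :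
    0 < mass D K p n fun b => ∀ i j, i < j → j ≤ N → j - i ≤ t →
      (∃ s, K ≤ ∑ q with blockSet q = s, overlap D p.length i j q ∧
        (∑ q with blockSet q = s, overlap D p.length i j q) + K ≤ (D s).card) →
      intervalSum (arranged p n b) i j ≠ 0 := by
  classical
  let good : ℕ × ℕ → Fin (r + 2) → Prop := fun x s =>
    K ≤ ∑ q with blockSet q = s, overlap D p.length x.1 x.2 q ∧
      (∑ q with blockSet q = s, overlap D p.length x.1 x.2 q) + K ≤ (D s).card
  let J : Finset (ℕ × ℕ) := (Finset.range (N + 1) ×ˢ Finset.range (N + 1)).filter fun x =>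
    x.1 < x.2 ∧ x.2 - x.1 ≤ t ∧ ∃ s, good x s
  have hJ : ∀ x ∈ J, x.1 < x.2 ∧ x.2 - x.1 ≤ t ∧ ∃ s, good x s := fun x hx =>
    (Finset.mem_filter.1 hx).2
  -- The set whose permutations serve the interval `x`; the default is never reached on `J`.
  let f : ℕ × ℕ → Fin (r + 2) := fun x => if h : ∃ s, good x s then h.choose else 0
  have hf : ∀ x ∈ J, good x (f x) := by
    intro x hx
    have h := (hJ x hx).2.2
    simp only [f]
    rw [dif_pos h]
    exact h.choose_spec
  -- Dependence is on blocks touching `f x`, not only on parts of it, because the permissibility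
  -- constraints dropped for `x` involve the partner blocks as well.
  let nbr : ℕ × ℕ → Finset (ℕ × ℕ) := fun x =>
    ((univ : Finset (Fin (4 * (r + 2)))).filter (Touches (f x))).biUnion fun q =>
      J.filter fun y => 0 < overlap D p.length y.1 y.2 q
  have hρ0 : 0 ≤ ρ := le_trans (by positivity) (hρ 0)
  have key := local_lemma (fun A => mass D K p n (· ∈ A)) (fun _ => mass_nonneg _) mass_add
    (by
      rw [mass_univ hD h4 hK1 hK fun b => Set.mem_univ b]
      exact_mod_cast card_acceptableSplits_pos hD h4 hK1 hK hη hacc)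
    J (fun x => {b | Vanishes D p n x.1 x.2 b}) nbr (8 * ((t + S) * t) + 1) ρ hρ0
    (by
      intro x _
      refine (Finset.card_biUnion_le_card_mul _ _ ((t + S) * t) fun q _ => ?_).trans
        ((Nat.mul_le_mul_right _ (card_touches_le (f x))).trans (Nat.le_succ _))
      refine (card_meeting_le D p.length t q _ (fun y hy => ?_) (fun y hy => ?_)).trans
        (Nat.mul_le_mul_right _ (Nat.add_le_add_left (hS q) t))
      · have := hJ y (Finset.mem_filter.1 hy).1
        exact ⟨this.1, this.2.1⟩
      · exact (Finset.mem_filter.1 hy).2)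
    (Nat.le_add_left _ _) hsmall
    (by
      intro x hx T hT hdis
      have hB : IndependentOf (f x)
          (· ∈ ⋂ l ∈ T, {b : Fin (4 * (r + 2)) → List G | Vanishes D p n l.1 l.2 b}ᶜ) := by
        intro b b' hbb'
        simp only [Set.mem_iInter, Set.mem_compl_iff, Set.mem_ofPred_eq]
        refine forall₂_congr fun y hy => not_congr (vanishes_congr fun q hq => hbb' q fun ht => ?_)
        exact Finset.disjoint_left.1 hdis hy (Finset.mem_biUnion.2
          ⟨q, Finset.mem_filter.2 ⟨Finset.mem_univ _, ht⟩, Finset.mem_filter.2 ⟨hT hy, hq⟩⟩)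
      obtain ⟨g1, g2⟩ := hf x hx
      refine le_trans (mass_mono fun w hw b hb h => ?_)
        ((mass_vanishes_le hD h4 hdisj hK1 hK hη hacc hB g1 g2).trans
          (mul_le_mul_of_nonneg_right (hρ _) (mass_nonneg _)))
      exact ⟨(vanishes_iff h4 hw hb _ _).1 h.1, h.2⟩)
  refine key.trans_le (mass_mono fun w hw b hb h i j hij hj ht hs => ?_)
  simp only [Set.mem_iInter, Set.mem_compl_iff, Set.mem_ofPred_eq] at h
  rw [Ne, ← vanishes_iff h4 hw hb]
  refine h (i, j) (Finset.mem_filter.2 ⟨?_, hij, ht, hs⟩)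
  rw [Finset.mem_product, Finset.mem_range, Finset.mem_range]
  simp only
  omega

end

/-! ### Numerical estimates -/

/-- From `C(m, K) ≥ (m / K)^K ≥ (√R)^K`. -/
theorem exp_le_choose {R : ℝ} (hR : 0 < R) {K m : ℕ} (hKm : K ≤ m)
    (h : Real.sqrt R * K ≤ m) : Real.exp (K * Real.log R / 2) ≤ m.choose K := by
  rcases Nat.eq_zero_or_pos K with rfl | hK
  · simp
  have h1 : (m : ℝ) ^ K ≤ m.choose K * (K : ℝ) ^ K := by
    exact_mod_cast pow_le_choose_mul_pow K m hKm
  have h2 : (Real.sqrt R) ^ K * (K : ℝ) ^ K ≤ m.choose K * (K : ℝ) ^ K := by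
    rw [← mul_pow]
    exact (pow_le_pow_left₀ (by positivity) h K).trans h1
  have h3 := le_of_mul_le_mul_right h2 (by positivity)
  refine le_trans (le_of_eq ?_) h3
  rw [show (K : ℝ) * Real.log R / 2 = K * (Real.log R / 2) by ring, Real.exp_nat_mul,
    ← Real.log_sqrt hR.le, Real.exp_log (Real.sqrt_pos.2 hR)]

/-- From `C(m, a) ≥ (m / a)^a ≥ 8^a` and `e² ≤ 8`. -/
theorem exp_le_choose_linear {m a : ℕ} (h : 8 * a ≤ m) :
    Real.exp (2 * a) ≤ m.choose a := by
  rcases Nat.eq_zero_or_pos a with rfl | ha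
  · simp
  have h1 : m ^ a ≤ m.choose a * a ^ a := pow_le_choose_mul_pow a m (by omega)
  have h2 : 8 ^ a * a ^ a ≤ m.choose a * a ^ a := by
    rw [← mul_pow]
    exact (Nat.pow_le_pow_left h a).trans h1
  have h3 : 8 ^ a ≤ m.choose a := Nat.le_of_mul_le_mul_right h2 (by positivity)
  have h4 : Real.exp 2 ≤ 8 := by
    have := Real.exp_one_lt_d9
    have h5 : Real.exp 2 = Real.exp 1 * Real.exp 1 := by rw [← Real.exp_add]; norm_num
    rw [h5]
    nlinarith [Real.exp_pos 1]
  calc Real.exp (2 * a) = Real.exp 2 ^ a := by rw [mul_comm, Real.exp_nat_mul]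
    _ ≤ 8 ^ a := pow_le_pow_left₀ (Real.exp_pos _).le h4 a
    _ ≤ _ := by exact_mod_cast h3

/-- The local lemma condition, numerically. -/
theorem local_lemma_condition {R β η : ℝ} {K t S : ℕ} (hβ : 0 ≤ β) (hη : 0 < η)
    (hK : 8 ≤ K) (hR : 0 < R) (hL : 16 ≤ Real.log R) (hRη : 72 * (1 + β) / η ≤ R)
    (hS : (S : ℝ) ≤ β * R) (ht : (t : ℝ) ≤ Real.exp K) :
    4 * (2 / η * Real.exp (-(K * Real.log R / 2))) * (8 * ((t + S) * t) + 1 : ℕ) ≤ 1 := by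
  have hR1 : 1 ≤ R := by
    by_contra h
    have := Real.log_nonpos hR.le (not_le.1 h).le
    linarith
  have hK8 : (8 : ℝ) ≤ K := by exact_mod_cast hK
  have he1 : 1 ≤ Real.exp K := Real.one_le_exp (by positivity)
  have he2 : Real.exp (2 * K) = Real.exp K * Real.exp K := by rw [← Real.exp_add]; ring_nf
  have ht0 : (0 : ℝ) ≤ t := by positivity
  have h1 : ((8 * ((t + S) * t) + 1 : ℕ) : ℝ) ≤ 9 * ((1 + β) * R * Real.exp (2 * K)) := by
    push_cast
    have h2 : ((t : ℝ) + S) * t ≤ (Real.exp K + β * R) * Real.exp K :=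
      mul_le_mul (add_le_add ht hS) ht ht0 (by positivity)
    have h3 : Real.exp K + β * R ≤ (1 + β) * R * Real.exp K := by
      have : β * R ≤ β * R * Real.exp K := le_mul_of_one_le_right (by positivity) he1
      have : Real.exp K ≤ R * Real.exp K := le_mul_of_one_le_left (by positivity) hR1
      nlinarith
    have h5 : ((t : ℝ) + S) * t ≤ (1 + β) * R * Real.exp (2 * K) := by
      rw [he2, ← mul_assoc]
      exact h2.trans (mul_le_mul_of_nonneg_right h3 (by positivity))
    have h6 : 1 ≤ (1 + β) * R * Real.exp (2 * K) :=
      one_le_mul_of_one_le_of_one_le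
        (one_le_mul_of_one_le_of_one_le (by linarith) hR1) (Real.one_le_exp (by positivity))
    linarith
  have hRexp : R = Real.exp (Real.log R) := (Real.exp_log hR).symm
  calc _ ≤ 4 * (2 / η * Real.exp (-(K * Real.log R / 2))) *
        (9 * ((1 + β) * R * Real.exp (2 * K))) := mul_le_mul_of_nonneg_left h1 (by positivity)
    _ = 72 * (1 + β) / η * (R * (Real.exp (2 * K) * Real.exp (-(K * Real.log R / 2)))) := by ring
    _ ≤ R * (R * (Real.exp (2 * K) * Real.exp (-(K * Real.log R / 2)))) :=
        mul_le_mul_of_nonneg_right hRη (by positivity)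
    _ = Real.exp (Real.log R + (Real.log R + (2 * K + -(K * Real.log R / 2)))) := by
        rw [Real.exp_add, Real.exp_add, Real.exp_add, Real.exp_log hR]
    _ ≤ 1 := by
        -- With `K ≥ 8` and `log R ≥ 16`, half of `K log R / 2` covers `2 log R` and the other half
        -- covers `2K`.
        rw [Real.exp_le_one_iff]
        nlinarith

/-- The part `y` of the exponent is sacrificed to absorb the constant `2 / η`. -/
theorem two_div_le_exp_neg {η C x y : ℝ} (hC : Real.exp (x + y) ≤ C)
    (hy : 2 / η ≤ Real.exp y) : 2 / (η * C) ≤ Real.exp (-x) := by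
  have hCpos : 0 < C := (Real.exp_pos _).trans_le hC
  rw [← div_div, div_le_iff₀ hCpos]
  calc 2 / η ≤ Real.exp y := hy
    _ = Real.exp (-x) * Real.exp (x + y) := by rw [← Real.exp_add]; congr 1; ring
    _ ≤ _ := mul_le_mul_of_nonneg_left hC (Real.exp_pos _).le

end OneShot
end

/-! ### The one-shot lemma: choice of constants and assembly -/

theorem mainTheorem3 (α β : ℝ) (hα : 0 < α) (hαβ : α ≤ β) :
    ∃ c₀ : ℝ, 0 < c₀ ∧ ∃ c : ℝ, 0 < c ∧ ∃ γ : ℝ, 0 < γ ∧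
    ∀ c₂ : ℝ, 0 < c₂ → c₂ ≤ c₀ → ∀ η : ℝ, 0 < η → ∃ R₀ : ℝ,
    ∀ R : ℝ, R₀ ≤ R → ∀ K : ℕ, K = ⌊c₂ * Real.sqrt R⌋₊ →
    ∀ (k : ℕ) [NeZero k] (r : ℕ) (D : Fin (r + 2) → Finset (ZMod k)) (p n : List (ZMod k)) (t : ℕ),
      (∀ j, OneShot.IsDissociated (D j)) →
      (∀ j, α * R ≤ ((D j).card : ℝ) ∧ ((D j).card : ℝ) ≤ β * R) →
      (∀ j, 4 ∣ (D j).card) →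
      (∀ i j, i ≠ j → Disjoint (D i) (D j)) →
      OneShot.IsDissociated (D 0 ∪ D (Fin.last (r + 1)) ∪ {OneShot.delta D}) →
      OneShot.IsWeakSequencing t (p.reverse ++ OneShot.delta D :: n) →
      η * ((OneShot.splits D).card : ℝ) ≤ ((OneShot.acceptableSplits D K p n).card : ℝ) →
      (t : ℝ) ≤ Real.exp (c * K) →
      -- the sampling procedure is well defined
      ((OneShot.acceptableSplits D K p n).Nonempty ∧
        ∀ w ∈ OneShot.acceptableSplits D K p n, (OneShot.arrangements K w).Nonempty) ∧
      -- Type II intervals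
      (∀ i j, OneShot.IsProperInterval (OneShot.totalLength D p n) i j → j - i ≤ t →
        OneShot.IsTypeII D p.length K i j →
        OneShot.prob D K p n (fun b => OneShot.intervalSum (OneShot.arranged p n b) i j = 0) ≤
          Real.exp (-(γ * (K * Real.log R)))) ∧
      -- Type I intervals
      (∀ i j, OneShot.IsProperInterval (OneShot.totalLength D p n) i j → j - i ≤ t →
        ¬ OneShot.IsTypeII D p.length K i j →
        OneShot.prob D K p n (fun b => OneShot.intervalSum (OneShot.arranged p n b) i j = 0) ≤
          Real.exp (-(γ * R))) ∧
      -- existence: all short intervals have nonzero sum, where the full interval is considered only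
      -- if its deterministic sum is nonzero
      0 < OneShot.prob D K p n (fun b =>
        (∀ i j, i < j → j ≤ OneShot.totalLength D p n → j - i ≤ t →
          (j - i < OneShot.totalLength D p n ∨ p.sum + OneShot.delta D + n.sum ≠ 0) →
          OneShot.intervalSum (OneShot.arranged p n b) i j ≠ 0) ∧
        OneShot.IsWeakSequencing t (OneShot.arranged p n b)) := by
  have hβ : 0 < β := hα.trans_le hαβ
  -- The bound on `c₂` gives `16 K² ≤ |T|` for every block. The two entries of `γ` belong to Type II
  -- and Type I; each is half of the available exponent, the rest absorbing `2 / η`.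
  refine ⟨min 1 α / 64, by positivity, 1, one_pos, min (1 / 4) (α / 8), by positivity, ?_⟩
  intro c₂ hc₂ hc₂0 η hη
  -- The summands ensure, in order: `K ≥ 8`, `log R ≥ 16`, the local lemma condition, and the
  -- absorption of `2 / η` for Type II and for Type I.
  refine ⟨(8 / c₂) ^ 2 + Real.exp 16 + 72 * (1 + β) / η + 2 / η + 16 * Real.exp 1 / (α * η), ?_⟩
  intro R hR K hKdef k _ r D p n t hD hcard h4 hdisj hU hW hacc ht
  have e1 : 0 ≤ (8 / c₂) ^ 2 := by positivity
  have e2 : 0 < Real.exp 16 := Real.exp_pos _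
  have e3 : 0 ≤ 72 * (1 + β) / η := by positivity
  have e4 : 0 ≤ 2 / η := by positivity
  have e5 : 0 ≤ 16 * Real.exp 1 / (α * η) := by positivity
  have hRpos : 0 < R := by linarith
  have hL : 16 ≤ Real.log R := by
    rw [Real.le_log_iff_exp_le hRpos]; linarith
  have hKle : (K : ℝ) ≤ c₂ * Real.sqrt R := by
    rw [hKdef]; exact Nat.floor_le (by positivity)
  have hK8 : 8 ≤ K := by
    rw [hKdef]
    refine Nat.le_floor ?_
    have : 8 / c₂ ≤ Real.sqrt R := Real.le_sqrt_of_sq_le (by linarith)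
    rw [div_le_iff₀ hc₂] at this
    push_cast
    linarith
  have hK8' : (8 : ℝ) ≤ K := by exact_mod_cast hK8
  have hK1 : 1 ≤ K := by omega
  have hc1 : c₂ ≤ 1 / 64 := hc₂0.trans (by have := min_le_left 1 α; linarith)
  have hcα : c₂ ≤ α / 64 := hc₂0.trans (by have := min_le_right 1 α; linarith)
  have hsq : Real.sqrt R * Real.sqrt R = R := Real.mul_self_sqrt hRpos.le
  have hsq0 : 0 < Real.sqrt R := Real.sqrt_pos.2 hRpos
  have hsize : ∀ q, ((OneShot.blockSize D q : ℕ) : ℝ) = ((D (OneShot.blockSet q)).card : ℝ) / 4 := by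
    intro q
    rw [OneShot.blockSize, Nat.cast_div (h4 _) (by norm_num)]
    norm_num
  have hK : ∀ q, 16 * K ^ 2 ≤ OneShot.blockSize D q := by
    intro q
    have h1 := (hcard (OneShot.blockSet q)).1
    have h2 : (K : ℝ) ^ 2 ≤ c₂ ^ 2 * R := by
      calc (K : ℝ) ^ 2 ≤ (c₂ * Real.sqrt R) ^ 2 := pow_le_pow_left₀ (by positivity) hKle 2
        _ = c₂ ^ 2 * R := by rw [mul_pow, sq (Real.sqrt R), hsq]
    have h3 : c₂ ^ 2 ≤ α / 64 * (1 / 64) := by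
      rw [sq]; exact mul_le_mul hcα hc1 hc₂.le (by positivity)
    have h5 : (16 * (K : ℝ) ^ 2) ≤ OneShot.blockSize D q := by
      rw [hsize]
      have := mul_le_mul_of_nonneg_right h3 hRpos.le
      have : 0 < α * R := by positivity
      nlinarith
    exact_mod_cast h5
  have h2K : ∀ q, 2 * K ≤ OneShot.blockSize D q := fun q => by have := hK q; nlinarith
  have hKle' : ∀ q, K ≤ OneShot.blockSize D q := fun q => by have := h2K q; omega
  have hnum : ∀ s, Real.exp (K * Real.log R / 2) ≤ (D s).card.choose K := by
    intro s
    have hs : Real.sqrt R * K ≤ (D s).card := by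
      calc Real.sqrt R * K ≤ Real.sqrt R * (c₂ * Real.sqrt R) :=
            mul_le_mul_of_nonneg_left hKle hsq0.le
        _ = c₂ * R := by rw [← hsq]; ring_nf; rw [Real.sq_sqrt (by positivity)]
        _ ≤ α * R := mul_le_mul_of_nonneg_right (by linarith) hRpos.le
        _ ≤ _ := (hcard s).1
    refine OneShot.exp_le_choose hRpos ?_ hs
    have h1 : 1 ≤ Real.sqrt R := by
      rw [Real.one_le_sqrt]
      have := Real.add_one_le_exp 16
      linarith
    have : (K : ℝ) ≤ (D s).card := le_trans (le_mul_of_one_le_left (by positivity) h1) hs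
    exact_mod_cast this
  have hdet : ∀ w ∈ OneShot.acceptableSplits D K p n, ∀ b ∈ OneShot.arrangements K w, ∀ i j,
      i < j → j ≤ OneShot.totalLength D p n → j - i ≤ t → j - i < OneShot.totalLength D p n →
      ¬ OneShot.IsTypeII D p.length K i j →
      (∀ q q' : Fin (4 * (r + 2)), OneShot.blockSet q = OneShot.blockSet q' →
        K ≤ OneShot.overlap D p.length i j q → K ≤ OneShot.overlap D p.length i j q') →
      OneShot.intervalSum (OneShot.arranged p n b) i j ≠ 0 :=
    fun w hw b hb i j hij hj hjt hprop hII hmix =>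
      OneShot.intervalSum_ne_zero hD h4 hdisj hK1 hKle' hW hw hb hij hj hjt hU hprop hII hmix
  have hII_bounds : ∀ i j, OneShot.IsTypeII D p.length K i j → ∃ s,
      K ≤ ∑ q with OneShot.blockSet q = s, OneShot.overlap D p.length i j q ∧
        (∑ q with OneShot.blockSet q = s, OneShot.overlap D p.length i j q) + K ≤ (D s).card := by
    rintro i j ⟨q, h1, h2⟩
    have h3 := OneShot.overlap_le_sum (D := D) p.length i j (q := q) rfl
    have h5 := OneShot.sum_overlap_add_le h4 p.length i j (q := q) rfl
    change K ≤ OneShot.overlap D p.length i j q at h1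
    change OneShot.overlap D p.length i j q + K ≤ _ at h2
    exact ⟨OneShot.blockSet q, by omega, by omega⟩
  refine ⟨⟨Finset.card_pos.1 (OneShot.card_acceptableSplits_pos hD h4 hK1 hK hη hacc),
    fun w hw => Finset.card_pos.1 (OneShot.card_arrangements_pos hD h4 hK1 hK
      (OneShot.mem_acceptableSplits.1 hw).1)⟩, ?_, ?_, ?_⟩
  · intro i j _ _ hII
    obtain ⟨s, h1, h2⟩ := hII_bounds i j hII
    refine (OneShot.prob_intervalSum_le hD h4 hdisj hK1 hK hη hacc h1 h2).trans ?_
    have h3 : 2 / (η * (D s).card.choose K) ≤ Real.exp (-(1 / 4 * (K * Real.log R))) := by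
      refine OneShot.two_div_le_exp_neg (y := K * Real.log R / 4)
        (le_trans (le_of_eq (by ring_nf)) (hnum s)) ?_
      calc 2 / η ≤ R := by linarith
        _ = Real.exp (Real.log R) := (Real.exp_log hRpos).symm
        _ ≤ _ := Real.exp_le_exp.2 (by nlinarith)
    refine h3.trans (Real.exp_le_exp.2 (neg_le_neg ?_))
    exact mul_le_mul_of_nonneg_right (min_le_left _ _) (by positivity)
  · intro i j hprop hjt hII
    by_cases hmix : ∀ q q' : Fin (4 * (r + 2)), OneShot.blockSet q = OneShot.blockSet q' →
        K ≤ OneShot.overlap D p.length i j q → K ≤ OneShot.overlap D p.length i j q'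
    · have h0 : OneShot.mass D K p n
          (fun b => OneShot.intervalSum (OneShot.arranged p n b) i j = 0) ≤
          OneShot.mass D K p n fun _ => False :=
        OneShot.mass_mono fun w hw b hb h =>
          hdet w hw b hb i j hprop.1 hprop.2.1 hjt hprop.2.2 hII hmix h
      have h1 : OneShot.mass D K p n (fun _ => False) = 0 := by simp [OneShot.mass]
      rw [OneShot.prob_eq]
      refine le_trans (div_nonpos_of_nonpos_of_nonneg (h0.trans h1.le) (by positivity))
        (Real.exp_pos _).le
    · obtain ⟨s, h1, h2⟩ := OneShot.exists_mixed h4 h2K hII hmix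
      refine (OneShot.prob_intervalSum_le hD h4 hdisj hK1 hK hη hacc h1 h2).trans ?_
      have h3 : 2 / (η * (D s).card.choose ((D s).card / 4 / 2)) ≤ Real.exp (-(α / 8 * R)) := by
        -- Rounding `|D s| / 8` down loses less than `1/2` in `a`, hence less than 1 in the exponent
        -- `2a`; this is the `-1`.
        refine OneShot.two_div_le_exp_neg (y := α * R / 8 - 1) ?_ ?_
        · refine le_trans (Real.exp_le_exp.2 ?_)
            (OneShot.exp_le_choose_linear (m := (D s).card) (a := (D s).card / 4 / 2) (by omega))
          have h5 : (D s).card ≤ 8 * ((D s).card / 4 / 2) + 4 := by have := h4 s; omega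
          have h6 : ((D s).card : ℝ) ≤ 8 * (((D s).card / 4 / 2 : ℕ) : ℝ) + 4 := by
            exact_mod_cast h5
          have := (hcard s).1
          linarith
        · have h7 : 16 * Real.exp 1 / (α * η) ≤ R := by linarith
          rw [div_le_iff₀ (by positivity)] at h7
          have h8 := Real.add_one_le_exp (α * R / 8)
          rw [Real.exp_sub, div_le_div_iff₀ hη (Real.exp_pos _)]
          nlinarith
      refine h3.trans (Real.exp_le_exp.2 (neg_le_neg ?_))
      exact mul_le_mul_of_nonneg_right (min_le_right _ _) hRpos.le
  · have hS : ∀ q, OneShot.blockSize D q ≤ ⌊β * R⌋₊ := by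
      intro q
      refine Nat.le_floor ?_
      rw [hsize]
      have := (hcard (OneShot.blockSet q)).2
      have : 0 < β * R := by positivity
      linarith
    have hρ : ∀ s, 2 / (η * (D s).card.choose K) ≤
        2 / η * Real.exp (-(K * Real.log R / 2)) := by
      intro s
      rw [← div_div, Real.exp_neg, ← div_eq_mul_inv]
      exact div_le_div_of_nonneg_left e4 (Real.exp_pos _) (hnum s)
    have hcond := OneShot.local_lemma_condition (S := ⌊β * R⌋₊) hβ.le hη hK8 hRpos hL (by linarith)
      (Nat.floor_le (by positivity)) (by simpa using ht)
    have hmass := OneShot.mass_avoid_pos hD h4 hdisj hK1 hK hη hacc hS hρ hcond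
      (OneShot.totalLength D p n)
    rw [OneShot.prob_eq]
    refine div_pos (hmass.trans_le (OneShot.mass_mono fun w hw b hb h => ?_))
      (by exact_mod_cast OneShot.card_acceptableSplits_pos hD h4 hK1 hK hη hacc)
    have hb' := hb
    rw [OneShot.arrangements_eq, OneShot.mem_arrangementsOn] at hb'
    have hlen := OneShot.length_of_mem h4 (OneShot.mem_acceptableSplits.1 hw).1 hb'.1
    have hN := OneShot.length_arranged h4 hlen p n
    have hshort : ∀ i j, i < j → j ≤ OneShot.totalLength D p n → j - i ≤ t →
        j - i < OneShot.totalLength D p n →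
        OneShot.intervalSum (OneShot.arranged p n b) i j ≠ 0 := by
      intro i j hij hj hjt hprop
      by_cases hII : OneShot.IsTypeII D p.length K i j
      · exact h i j hij hj hjt (hII_bounds i j hII)
      by_cases hmix : ∀ q q' : Fin (4 * (r + 2)), OneShot.blockSet q = OneShot.blockSet q' →
          K ≤ OneShot.overlap D p.length i j q → K ≤ OneShot.overlap D p.length i j q'
      · exact hdet w hw b hb i j hij hj hjt hprop hII hmix
      -- In the local lemma, mixed Type I intervals are treated like Type II: half a block is at
      -- least `K`, and the weaker bound suffices.
      · obtain ⟨s, h1, h2⟩ := OneShot.exists_mixed h4 h2K hII hmix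
        obtain ⟨q, rfl⟩ : ∃ q, OneShot.blockSet q = s := ⟨_, OneShot.blockSet_symm s 0⟩
        have h3 : (D (OneShot.blockSet q)).card / 4 = OneShot.blockSize D q := rfl
        have h5 := h2K q
        exact h i j hij hj hjt ⟨OneShot.blockSet q, by omega, by omega⟩
    refine ⟨fun i j hij hj hjt hor => ?_, fun i j hp hjt heq => ?_⟩
    · by_cases hprop : j - i < OneShot.totalLength D p n
      · exact hshort i j hij hj hjt hprop
      · obtain rfl : i = 0 := by omega
        have hsum : OneShot.intervalSum (OneShot.arranged p n b) 0 j =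
            p.sum + OneShot.delta D + n.sum := by
          rw [OneShot.intervalSum_to_end (by rw [hN]; omega), List.drop_zero, OneShot.arranged,
            List.sum_append, List.sum_append, List.sum_reverse, List.sum_flatten, List.map_ofFn,
            List.sum_ofFn]
          congr 2
          exact OneShot.sum_arrangement h4 hw hb
        rw [hsum]
        exact hor.resolve_left hprop
    · have h1 := OneShot.sum_take_eq (OneShot.arranged p n b) hp.1.le
      rw [heq, left_eq_add] at h1
      rw [hN] at hp
      exact hshort i j hp.1 hp.2.1 hjt hp.2.2 h1
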